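/- Let $m>1$, $\chi>0$ and let $N\ge 2$ be an integer. For $p\ge 2$ let $\mathcal R^p=\{X\in\mathbb R^p : X_1<\dots<X_p,\ \sum_i X_i=0\}$, let $|\cdot|$ be the Euclidean norm, and let $$\mathcal F^p_m(X)=\frac1{m-1}\sum_{i=1}^{p-1}(X_{i+1}-X_i)^{1-m}-\frac{\chi}{m-1}\sum_{1\le i\ne j\le p}|X_j-X_i|^{1-m},\qquad \frac1{C_p}=\sup_{X\in\mathcal R^p}\frac{\sum_{1\le i\neq j\le p}|X_j-X_i|^{1-m}}{\sum_{i=1}^{p-1}(X_{i+1}-X_i)^{1-m}} .$$ (For $p=1$ both sums are empty; $C_1=+\infty$ by convention and is never equal to $\chi$.) For $X_0\in\mathcal R^N$ let $X:[0,T)\to\mathcal R^N$ be the solution with $X(0)=X_0$ and maximal time of existence $T\in(0,+\infty]$ of the gradient flow $$\dot X_i=-(X_{i+1}-X_i)^{-m}+(X_i-X_{i-1})^{-m}+2\chi\sum_{j\ne i}\operatorname{sign}(j-i)\,|X_j-X_i|^{-m},\qquad 1\le i\le N,$$ where the first term is omitted for $i=N$ and the second one for $i=1$. A curve $Z$ defined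 on $[0,T)$ is said to blow up at $T$ if there are an index $i$ and times $t_n\to T$ in $[0,T)$ with $Z_{i+1}(t_n)-Z_i(t_n)\to0$. A set $\mathcal I=\{l,\dots,r\}\subset\{1,\dots,N\}$ with $l<r$ is a relative blow-up set of a sequence $(Y^n)$ in $\mathcal R^N$ if, for every $i\in\mathcal J=\{l,\dots,r-1\}$: (a) $Y^n_{i+1}-Y^n_i\to0$; (b) for every $k\in\{1,\dots,N-1\}$ the quotient $(Y^n_{i+1}-Y^n_i)/(Y^n_{k+1}-Y^n_k)$ has a finite limit; (c) this limit is $0$ for $k\in\{l-1,r\}\cap\{1,\dots,N-1\}$. **Theorem (super critical regime).** Assume $\chi>C_N$, and let $X_0\in\mathcal R^N$ be arbitrary. 1. If $\chi\ne C_p$ for all $1\le p\le N-1$, then $X$ blows up in finite time: $T<+\infty$ and $X$ blows up at $T$. 2. If $\chi=C_p$ for some $1\le p\le N-1$, then either $X$ blows up in finite time ($T<+\infty$ and $X$ blows up at $T$), or $T=+\infty$ and $Y=X/|X|$ blows up at $+\infty$. In the latter case: * whenever $t_n\to+\infty$ and some gap $Y_{i+1}(t_n)-Y_i(t_n)$ tends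 to $0$, a subsequence of $(Y(t_n))$ has a relative blow-up set; * the functional $\mathcal F^p_m$ has a critical point $V\in\mathcal R^p$ with $\sum_{k=1}^{p-1}(V_{k+1}-V_k)^2=1$, and every critical point of $\mathcal F^p_m$ in $\mathcal R^p$ is of the form $aV$ with $a>0$; * for every sequence $t_n\to+\infty$, every relative blow-up set $\mathcal I=\{l,\dots,r\}$ of $(Y(t_n))$ has exactly $p$ elements, and the renormalised block converges to $V$: $$\frac{Y_{l+k-1}(t_n)-\frac1p\sum_{i\in\mathcal I}Y_i(t_n)}{\Big(\sum_{i=l}^{r-1}(Y_{i+1}(t_n)-Y_i(t_n))^2\Big)^{1/2}}\longrightarrow V_k\qquad(1\le k\le p).$$ -/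

import Mathlib

open Filter Topology

noncomputable section

namespace ParticleFlow

/-- Positions of `N` particles on the line; the norm is the Euclidean one. -/
abbrev Config (N : ℕ) : Type := EuclideanSpace ℝ (Fin N)

/-- The space `𝓡^N` of strictly ordered configurations with centre of mass `0`. -/
def orderedConfigs (N : ℕ) : Set (Config N) :=
  {X | (∀ i j : Fin N, i < j → X i < X j) ∧ ∑ i, X i = 0}

/-- The gap `X_{i+1} - X_i` between consecutive particles (`N` particles have `N - 1` gaps). -/
def gap {N : ℕ} (X : Config N) (i : Fin (N - 1)) : ℝ :=
  X ⟨(i : ℕ) + 1, by omega⟩ - X ⟨(i : ℕ), by omega⟩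

/-- `∑_{i=1}^{N-1} (X_{i+1} - X_i)^{1-m}`. -/
def gapSum (m : ℝ) {N : ℕ} (X : Config N) : ℝ :=
  ∑ i : Fin (N - 1), gap X i ^ (1 - m)

/-- `∑_{i ≠ j} |X_j - X_i|^{1-m}`, the sum being over ordered pairs. -/
def pairSum (m : ℝ) {N : ℕ} (X : Config N) : ℝ :=
  ∑ i : Fin N, ∑ j : Fin N with j ≠ i, |X j - X i| ^ (1 - m)

/-- The discrete energy `𝓕^N_m` with interaction coefficient `χ`. -/
def energy (m χ : ℝ) {N : ℕ} (X : Config N) : ℝ :=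
  1 / (m - 1) * gapSum m X - χ / (m - 1) * pairSum m X

/-- The threshold `C_p`, for `p ≥ 2`:
`1 / C_p` is the supremum over `𝓡^p` of the quotient of the two sums. -/
def threshold (m : ℝ) (p : ℕ) : ℝ :=
  (sSup ((fun X : Config p => pairSum m X / gapSum m X) '' orderedConfigs p))⁻¹

/-- The right-hand side of the particle system. The gap to the left of the first particle
and the gap to the right of the last particle do not contribute. -/
def velocity (m χ : ℝ) {N : ℕ} (X : Config N) : Config N :=
  WithLp.toLp 2 fun i : Fin N =>
    -(if h : (i : ℕ) + 1 < N then (X ⟨(i : ℕ) + 1, h⟩ - X i) ^ (-m) else 0)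
    + (if 0 < (i : ℕ) then (X i - X ⟨(i : ℕ) - 1, by omega⟩) ^ (-m) else 0)
    + 2 * χ * ∑ j : Fin N with j ≠ i,
        ((Int.sign ((j : ℤ) - (i : ℤ)) : ℤ) : ℝ) * |X j - X i| ^ (-m)

/-- `X` is a solution of the particle system on `[0, T)`, with `T ∈ (0, +∞]`, started at `X₀`. -/
structure IsSolution (m χ : ℝ) {N : ℕ} (X₀ : Config N) (T : EReal) (X : ℝ → Config N) :
    Prop where
  pos : 0 < T
  init : X 0 = X₀
  mem : ∀ t : ℝ, 0 ≤ t → (t : EReal) < T → X t ∈ orderedConfigs N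
  ode : ∀ t : ℝ, 0 ≤ t → (t : EReal) < T →
    HasDerivWithinAt X (velocity m χ (X t)) {s : ℝ | 0 ≤ s ∧ (s : EReal) < T} t

/-- `X` is the solution started at `X₀`, and `T` is its maximal time of existence. -/
structure IsMaximalSolution (m χ : ℝ) {N : ℕ} (X₀ : Config N) (T : EReal) (X : ℝ → Config N) :
    Prop where
  sol : IsSolution m χ X₀ T X
  maximal : ∀ (T' : EReal) (X' : ℝ → Config N), IsSolution m χ X₀ T' X' → T' ≤ T

/-- The sequence of times `t_n ∈ [0, T)` tends to `T`. -/
def TimesTo (T : EReal) (t : ℕ → ℝ) : Prop :=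
  (∀ n, 0 ≤ t n ∧ (t n : EReal) < T) ∧ Tendsto (fun n => (t n : EReal)) atTop (𝓝 T)

/-- The curve `X` blows up at `T`: some gap tends to `0` along some sequence of times
tending to `T`. -/
def BlowsUp {N : ℕ} (T : EReal) (X : ℝ → Config N) : Prop :=
  ∃ (i : Fin (N - 1)) (t : ℕ → ℝ),
    TimesTo T t ∧ Tendsto (fun n => gap (X (t n)) i) atTop (𝓝 0)

/-- The renormalised curve `Y = X / |X|`. -/
def normalized {N : ℕ} (X : ℝ → Config N) (t : ℝ) : Config N := ‖X t‖⁻¹ • X t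

/-- The set `𝓙` of the gaps inside the block of consecutive particles `[l, r]`. -/
def innerGaps {N : ℕ} (l r : Fin N) : Finset (Fin (N - 1)) :=
  {i | (l : ℕ) ≤ (i : ℕ) ∧ (i : ℕ) < (r : ℕ)}

/-- The set `∂𝓙` of the gaps between the block `[l, r]` and its nearest neighbours. -/
def boundaryGaps {N : ℕ} (l r : Fin N) : Finset (Fin (N - 1)) :=
  {j | (j : ℕ) + 1 = (l : ℕ) ∨ (j : ℕ) = (r : ℕ)}

/-- The block `[l, r]` of at least two consecutive particles is a relative blow-up set for the
sequence `X`. The second condition says that the limit exists and is finite. -/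
structure IsRelativeBlowUpSet {N : ℕ} (X : ℕ → Config N) (l r : Fin N) : Prop where
  lt : l < r
  collapse : ∀ i ∈ innerGaps l r, Tendsto (fun n => gap (X n) i) atTop (𝓝 0)
  fastest : ∀ i ∈ innerGaps l r, ∀ k : Fin (N - 1),
    ∃ c : ℝ, Tendsto (fun n => gap (X n) i / gap (X n) k) atTop (𝓝 c)
  isolated : ∀ i ∈ innerGaps l r, ∀ j ∈ boundaryGaps l r,
    Tendsto (fun n => gap (X n) i / gap (X n) j) atTop (𝓝 0)

/-- `Π_𝓘(X)`, the Euclidean norm of the vector of the gaps inside the block `[l, r]`. -/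
def blockSize {N : ℕ} (X : Config N) (l r : Fin N) : ℝ :=
  √(∑ i ∈ innerGaps l r, gap X i ^ 2)

/-- The centre of mass of the block `[l, r]`. -/
def blockCenter {N : ℕ} (X : Config N) (l r : Fin N) : ℝ :=
  (∑ i ∈ Finset.Icc l r, X i) / ((Finset.Icc l r).card : ℝ)

/-- The block `[l, r]` of `X n`, centred and divided by `Π_𝓘(X n)`, converges to the
configuration `V` of `p` particles (used for a block of exactly `p` particles; the particle
number `k` of `V` corresponds to the particle number `l + k` of `X n`). -/
def BlockConvergesTo {N p : ℕ} (X : ℕ → Config N) (l r : Fin N) (V : Config p) : Prop :=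
  ∀ (i : Fin N) (k : Fin p), (i : ℕ) = (l : ℕ) + (k : ℕ) →
    Tendsto (fun n => (X n i - blockCenter (X n) l r) / blockSize (X n) l r) atTop (𝓝 (V k))

/-- `V ∈ 𝓡^p` is a critical point of `𝓕^p_m`. (The energy is translation invariant, so that its
gradient is always tangent to the hyperplane of centred configurations.) -/
def IsCriticalPoint (m χ : ℝ) {p : ℕ} (V : Config p) : Prop :=
  V ∈ orderedConfigs p ∧ HasGradientAt (energy m χ : Config p → ℝ) 0 V

end ParticleFlow

end

/-! A maximal solution whose gaps stay bounded below has bounded velocity and can be continued past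
any finite time. Hence `T < ⊤` already implies blow-up (`IsMaximalSolution.blowsUp`), and only
global solutions remain.

Along a global solution the energy decreases and, by Euler's identity, |X|² has derivative 2(m-1)
times the energy, so the energy is never negative. The energy of Y = X/|X| decreases too, at the
rate |X|^{-(m+1)} `tangentialSq`(Y). Since |X|^{m+1} grows at most linearly, the weight |X|^{-(m+1)}
is not integrable in time. If the gaps of Y were bounded below, compactness would bound
`tangentialSq` away from zero, because above C_N no configuration of nonnegative energy has a radial
velocity (`ne_smul_of_energy_nonneg`). Hence Y blows up (`IsGlobalFlow.blowsUp_normalized`).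

Zoom in on a relative blow-up set of size ε. If ε^m |velocity(Y)| did not tend to 0, the solution
would dissipate energy of order ε^{1-m} while moving by a fraction of the smallest gap, more than
the bounded renormalised energy allows (`IsGlobalFlow.exists_velocity_lt`). Forces from outside the
block vanish at this scale, so the rescaled block tends to a critical point of the energy of p
particles.

Critical points are rigid. A critical V supplies the weights of a Jensen inequality which makes the
energy nonnegative on all configurations of p particles (`IsCertificate.pair_le_gap`), with equality
only at dilates of V; thus χ = C_p. Dropping particles from V leaves slack, so χ < C_q for 2 ≤ q <
p; adding distant particles makes the energy negative, so χ > C_q for q > p. Therefore χ determines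
p, and a global solution can exist only if χ is a threshold with p < N. -/

noncomputable section

namespace ParticleFlow

/-! ### Gradient structure and homogeneity of the vector field. -/

/-- The linear form `X ↦ X_{k+1} - X_k`. -/
def gapForm {N : ℕ} (k : Fin (N - 1)) : Config N →L[ℝ] ℝ :=
  EuclideanSpace.proj (⟨(k : ℕ) + 1, by omega⟩ : Fin N) -
    EuclideanSpace.proj (⟨(k : ℕ), by omega⟩ : Fin N)

@[simp] lemma gapForm_apply {N : ℕ} (k : Fin (N - 1)) (X : Config N) :
    gapForm k X = gap X k := rfl

lemma gap_pos {N : ℕ} {X : Config N} (hX : ∀ i j : Fin N, i < j → X i < X j) (k : Fin (N - 1)) :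
    0 < gap X k :=
  sub_pos.2 (hX _ _ (by simp [Fin.lt_def]))

lemma sign_mul_abs_of_ordered {N : ℕ} {X : Config N} (hX : ∀ i j : Fin N, i < j → X i < X j)
    {i j : Fin N} (hij : j ≠ i) :
    ((SignType.sign (X j - X i) : ℝ)) = ((Int.sign ((j : ℤ) - (i : ℤ)) : ℤ) : ℝ) := by
  rcases lt_or_gt_of_ne hij with h | h
  · have h1 : X j - X i < 0 := sub_neg.2 (hX _ _ h)
    have h2 : ((j : ℤ) - (i : ℤ)) < 0 := by have := Fin.lt_def.1 h; omega
    simp [sign_neg h1, Int.sign_eq_neg_one_of_neg h2]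
  · have h1 : 0 < X j - X i := sub_pos.2 (hX _ _ h)
    have h2 : 0 < ((j : ℤ) - (i : ℤ)) := by have := Fin.lt_def.1 h; omega
    simp [sign_pos h1, Int.sign_eq_one_of_pos h2]

lemma sum_mul_right_gap {N : ℕ} (ξ X : Config N) (q : ℝ) :
    ∑ i : Fin N, ξ i * (if h : (i : ℕ) + 1 < N then (X ⟨(i : ℕ) + 1, h⟩ - X i) ^ q else 0) =
      ∑ k : Fin (N - 1), ξ ⟨k, by omega⟩ * gap X k ^ q := by
  obtain _ | n := N
  · simp
  · rw [Fin.sum_univ_castSucc]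
    simp only [Fin.val_last, lt_irrefl, dite_false, mul_zero, add_zero]
    refine Finset.sum_congr rfl fun k _ => ?_
    have : (k.castSucc : ℕ) + 1 < n + 1 := by simp
    rw [dif_pos this]
    rfl

lemma sum_mul_left_gap {N : ℕ} (ξ X : Config N) (q : ℝ) :
    ∑ i : Fin N, ξ i * (if 0 < (i : ℕ) then (X i - X ⟨(i : ℕ) - 1, by omega⟩) ^ q else 0) =
      ∑ k : Fin (N - 1), ξ ⟨(k : ℕ) + 1, by omega⟩ * gap X k ^ q := by
  obtain _ | n := N
  · simp
  · rw [Fin.sum_univ_succ]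
    simp only [Fin.val_zero, lt_irrefl, if_false, mul_zero, zero_add]
    refine Finset.sum_congr rfl fun k _ => ?_
    have : 0 < (k.succ : ℕ) := by simp
    rw [if_pos this]
    rfl

/-- Exchanging i and j reverses the sign factor and keeps the distance, so the ξ_j half of the sum
equals the -ξ_i half. -/
lemma sum_antisymm_pair {N : ℕ} (ξ X : Config N) (q : ℝ) :
    ∑ i : Fin N, ∑ j : Fin N with j ≠ i,
        ((Int.sign ((j : ℤ) - (i : ℤ)) : ℤ) : ℝ) * (ξ j - ξ i) * |X j - X i| ^ q =
      -2 * ∑ i : Fin N, ξ i * ∑ j : Fin N with j ≠ i,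
        ((Int.sign ((j : ℤ) - (i : ℤ)) : ℤ) : ℝ) * |X j - X i| ^ q := by
  have h1 : ∑ i : Fin N, ∑ j : Fin N with j ≠ i,
        ((Int.sign ((j : ℤ) - (i : ℤ)) : ℤ) : ℝ) * ξ j * |X j - X i| ^ q =
      - ∑ i : Fin N, ∑ j : Fin N with j ≠ i,
        ((Int.sign ((j : ℤ) - (i : ℤ)) : ℤ) : ℝ) * ξ i * |X j - X i| ^ q := by
    rw [← Finset.sum_neg_distrib]
    simp only [Finset.sum_filter, ← Finset.sum_neg_distrib]
    rw [Finset.sum_comm]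
    refine Finset.sum_congr rfl fun i _ => Finset.sum_congr rfl fun j _ => ?_
    by_cases h : j = i
    · simp [h]
    · rw [if_pos h, if_pos (Ne.symm h), abs_sub_comm,
        show ((i : ℤ) - (j : ℤ)) = -((j : ℤ) - (i : ℤ)) by ring, Int.sign_neg]
      push_cast
      ring
  simp only [mul_sub, sub_mul, Finset.sum_sub_distrib]
  rw [h1]
  simp only [Finset.mul_sum]
  rw [← Finset.sum_neg_distrib, ← Finset.sum_sub_distrib]
  refine Finset.sum_congr rfl fun i _ => ?_
  rw [← Finset.sum_neg_distrib, ← Finset.sum_sub_distrib]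
  refine Finset.sum_congr rfl fun i _ => ?_
  ring

/-- The weak form of the particle system. -/
lemma inner_velocity (m χ : ℝ) {N : ℕ} (ξ X : Config N) :
    inner ℝ (velocity m χ X) ξ = ∑ k : Fin (N - 1), gap X k ^ (-m) * gap ξ k
      - χ * ∑ i : Fin N, ∑ j : Fin N with j ≠ i,
        ((Int.sign ((j : ℤ) - (i : ℤ)) : ℤ) : ℝ) * (ξ j - ξ i) * |X j - X i| ^ (-m) := by
  rw [sum_antisymm_pair]
  have h1 := sum_mul_right_gap ξ X (-m)
  have h2 := sum_mul_left_gap ξ X (-m)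
  have h3 : ∑ k : Fin (N - 1), gap X k ^ (-m) * gap ξ k =
      ∑ k : Fin (N - 1), ξ ⟨(k : ℕ) + 1, by omega⟩ * gap X k ^ (-m) -
      ∑ k : Fin (N - 1), ξ ⟨k, by omega⟩ * gap X k ^ (-m) := by
    rw [← Finset.sum_sub_distrib]
    refine Finset.sum_congr rfl fun k _ => ?_
    rw [gap, gap]; ring
  rw [h3, ← h1, ← h2]
  simp only [PiLp.inner_apply, velocity, RCLike.inner_apply, conj_trivial]
  rw [← Finset.sum_sub_distrib, ← mul_assoc, Finset.mul_sum, ← Finset.sum_sub_distrib]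
  refine Finset.sum_congr rfl fun i _ => ?_
  ring

lemma hasFDerivAt_gapSum {m : ℝ} {N : ℕ} {X : Config N}
    (hX : ∀ i j : Fin N, i < j → X i < X j) :
    HasFDerivAt (gapSum m : Config N → ℝ)
      (∑ k : Fin (N - 1), ((1 - m) * gap X k ^ (-m)) • gapForm k) X := by
  unfold gapSum
  refine HasFDerivAt.fun_sum fun k _ => ?_
  have h := (gapForm k).hasFDerivAt (x := X)
  have h2 := h.rpow_const (p := 1 - m) (Or.inl (gap_pos hX k).ne')
  rw [show (1 - m - 1) = -m by ring] at h2
  exact h2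

lemma hasFDerivAt_pairSum {m : ℝ} {N : ℕ} {X : Config N}
    (hX : ∀ i j : Fin N, i < j → X i < X j) :
    HasFDerivAt (pairSum m : Config N → ℝ)
      (∑ i : Fin N, ∑ j : Fin N with j ≠ i,
        ((1 - m) * |X j - X i| ^ (-m) * ((Int.sign ((j : ℤ) - (i : ℤ)) : ℤ) : ℝ)) •
          ((EuclideanSpace.proj j - EuclideanSpace.proj i : Config N →L[ℝ] ℝ))) X := by
  unfold pairSum
  refine HasFDerivAt.fun_sum fun i _ => HasFDerivAt.fun_sum fun j hj => ?_
  have hj : j ≠ i := by simpa using hj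
  have hne : X j - X i ≠ 0 := by
    rcases lt_or_gt_of_ne hj with h | h
    · exact (sub_neg.2 (hX _ _ h)).ne
    · exact (sub_pos.2 (hX _ _ h)).ne'
  have h := (EuclideanSpace.proj j - EuclideanSpace.proj i : Config N →L[ℝ] ℝ).hasFDerivAt (x := X)
  have h2 := (hasDerivAt_abs hne).rpow_const (p := 1 - m) (Or.inl (abs_ne_zero.2 hne))
  have h3 := HasDerivAt.comp_hasFDerivAt X (h₂ := fun x : ℝ => |x| ^ (1 - m))
    (f := (EuclideanSpace.proj j - EuclideanSpace.proj i : Config N →L[ℝ] ℝ)) h2 h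
  rw [show (1 - m - 1) = -m by ring, sign_mul_abs_of_ordered hX hj] at h3
  refine h3.congr_fderiv ?_
  congr 1
  ring

lemma hasGradientAt_energy {m χ : ℝ} (hm : 1 < m) {N : ℕ} {X : Config N}
    (hX : ∀ i j : Fin N, i < j → X i < X j) :
    HasGradientAt (energy m χ : Config N → ℝ) (-velocity m χ X) X := by
  have hm' : m - 1 ≠ 0 := by linarith
  rw [hasGradientAt_iff_hasFDerivAt]
  have h := ((hasFDerivAt_gapSum (m := m) hX).const_mul (1 / (m - 1))).sub
    ((hasFDerivAt_pairSum (m := m) hX).const_mul (χ / (m - 1)))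
  refine h.congr_fderiv ?_
  ext ξ
  simp only [map_neg, neg_apply, InnerProductSpace.toDual_apply_apply,
    inner_velocity, sub_apply, smul_apply, sum_apply, gapForm_apply, smul_eq_mul,
    PiLp.proj_apply, neg_sub,
    Finset.mul_sum]
  have e : ∀ a b c d : ℝ, a = -d → b = -c → a - b = c - d := by
    rintro a b c d rfl rfl; ring
  apply e
  · rw [← Finset.sum_neg_distrib]
    refine Finset.sum_congr rfl fun k _ => ?_
    field_simp; ring
  · rw [← Finset.sum_neg_distrib]
    refine Finset.sum_congr rfl fun i _ => ?_
    rw [← Finset.sum_neg_distrib]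
    refine Finset.sum_congr rfl fun j _ => ?_
    field_simp; ring

lemma isCriticalPoint_iff {m χ : ℝ} (hm : 1 < m) {N : ℕ} {X : Config N} :
    IsCriticalPoint m χ X ↔ X ∈ orderedConfigs N ∧ velocity m χ X = 0 := by
  refine and_congr_right fun hX => ⟨fun h => ?_, fun h => ?_⟩
  · have := h.unique (hasGradientAt_energy hm hX.1)
    simpa using this.symm
  · simpa [h] using hasGradientAt_energy (χ := χ) hm hX.1

/-- Euler's identity for the energy, which is homogeneous of degree 1 - m; it follows from the weak
form tested with X itself. -/
lemma inner_velocity_self {m χ : ℝ} (hm : 1 < m) {N : ℕ} {X : Config N}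
    (hX : ∀ i j : Fin N, i < j → X i < X j) :
    inner ℝ (velocity m χ X) X = (m - 1) * energy m χ X := by
  have hm' : m - 1 ≠ 0 := by linarith
  rw [inner_velocity, energy, gapSum, pairSum]
  have h1 : ∀ k : Fin (N - 1), gap X k ^ (-m) * gap X k = gap X k ^ (1 - m) := fun k => by
    rw [← Real.rpow_add_one (gap_pos hX k).ne']; ring_nf
  have h2 : ∀ i : Fin N, ∀ j ∈ Finset.univ.filter (fun j : Fin N => j ≠ i),
      ((Int.sign ((j : ℤ) - (i : ℤ)) : ℤ) : ℝ) * (X j - X i) * |X j - X i| ^ (-m) =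
        |X j - X i| ^ (1 - m) := fun i j hj => by
    have hj : j ≠ i := by simpa using hj
    have hne : X j - X i ≠ 0 := by
      rcases lt_or_gt_of_ne hj with h | h
      · exact (sub_neg.2 (hX _ _ h)).ne
      · exact (sub_pos.2 (hX _ _ h)).ne'
    rw [← sign_mul_abs_of_ordered hX hj, sign_mul_self, mul_comm,
      ← Real.rpow_add_one (abs_ne_zero.2 hne)]
    ring_nf
  simp only [h1]
  rw [Finset.sum_congr rfl fun i _ => Finset.sum_congr rfl (h2 i)]
  field_simp

lemma sum_velocity (m χ : ℝ) {N : ℕ} (X : Config N) : ∑ i, velocity m χ X i = 0 := by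
  have h := inner_velocity m χ (WithLp.toLp 2 fun _ => 1) X
  simpa [PiLp.inner_apply, gap] using h

@[simp] lemma gap_smul {N : ℕ} (a : ℝ) (X : Config N) (k : Fin (N - 1)) :
    gap (a • X) k = a * gap X k := by simp [gap, mul_sub]

lemma velocity_smul {m χ : ℝ} {N : ℕ} {a : ℝ} (ha : 0 < a) {X : Config N}
    (hX : ∀ i j : Fin N, i < j → X i < X j) :
    velocity m χ (a • X) = a ^ (-m) • velocity m χ X := by
  have key : ∀ q u : ℝ, 0 ≤ u → (a * u) ^ q = a ^ q * u ^ q := fun q u hu =>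
    Real.mul_rpow ha.le hu
  ext i
  simp only [velocity, PiLp.smul_apply, smul_eq_mul, ← mul_sub, abs_mul, abs_of_pos ha]
  rw [mul_add, mul_add, mul_neg, mul_dite, mul_ite, mul_zero]
  congr 1
  · congr 1
    · congr 1
      split_ifs with h
      · exact key _ _ (sub_nonneg.2 (hX _ _ (by simp [Fin.lt_def])).le)
      · rfl
    · split_ifs with h
      · exact key _ _ (sub_nonneg.2 (hX _ _ (by simp [Fin.lt_def]; omega)).le)
      · rfl
  · rw [mul_left_comm, Finset.mul_sum (a := a ^ (-m))]
    congr 1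
    refine Finset.sum_congr rfl fun j _ => ?_
    rw [key _ _ (abs_nonneg _)]
    ring

lemma gapSum_smul {m : ℝ} {N : ℕ} {a : ℝ} (ha : 0 < a) {X : Config N}
    (hX : ∀ i j : Fin N, i < j → X i < X j) :
    gapSum m (a • X) = a ^ (1 - m) * gapSum m X := by
  simp only [gapSum, gap_smul, Finset.mul_sum]
  exact Finset.sum_congr rfl fun k _ => Real.mul_rpow ha.le (gap_pos hX k).le

lemma pairSum_smul {m : ℝ} {N : ℕ} {a : ℝ} (ha : 0 < a) (X : Config N) :
    pairSum m (a • X) = a ^ (1 - m) * pairSum m X := by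
  simp only [pairSum, PiLp.smul_apply, smul_eq_mul, ← mul_sub, abs_mul, abs_of_pos ha,
    Finset.mul_sum]
  exact Finset.sum_congr rfl fun i _ => Finset.sum_congr rfl fun j _ =>
    Real.mul_rpow ha.le (abs_nonneg _)

lemma energy_smul {m χ : ℝ} {N : ℕ} {a : ℝ} (ha : 0 < a) {X : Config N}
    (hX : ∀ i j : Fin N, i < j → X i < X j) :
    energy m χ (a • X) = a ^ (1 - m) * energy m χ X := by
  rw [energy, gapSum_smul ha hX, pairSum_smul ha, energy]
  ring

lemma smul_mem_orderedConfigs {N : ℕ} {a : ℝ} (ha : 0 < a) {X : Config N}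
    (hX : X ∈ orderedConfigs N) : a • X ∈ orderedConfigs N :=
  ⟨fun i j h => by simpa using mul_lt_mul_of_pos_left (hX.1 i j h) ha, by
    simp [← Finset.mul_sum, hX.2]⟩

/-! ### Jensen certificates for the inequality between the two sums. -/

/-- The sum of the gaps to the power `1 - m`, for the first `n` terms of a sequence. -/
def seqGap (m : ℝ) (x : ℕ → ℝ) (n : ℕ) : ℝ :=
  ∑ k ∈ Finset.range (n - 1), (x (k + 1) - x k) ^ (1 - m)

/-- The sum of the distances to the power `1 - m`, for the first `n` terms of a sequence. -/
def seqPair (m : ℝ) (x : ℕ → ℝ) (n : ℕ) : ℝ :=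
  ∑ j ∈ Finset.range n, ∑ i ∈ Finset.range j, (x j - x i) ^ (1 - m)

/-- The total attraction across the gap number `k`, for the first `n` terms of a sequence. -/
def seqCross (m : ℝ) (x : ℕ → ℝ) (n k : ℕ) : ℝ :=
  ∑ i ∈ Finset.range (k + 1), ∑ j ∈ Finset.Ico (k + 1) n, (x j - x i) ^ (-m)

lemma strictConvexOn_rpow_of_neg {q : ℝ} (hq : q < 0) :
    StrictConvexOn ℝ (Set.Ioi 0) (fun u : ℝ => u ^ q) := by
  refine StrictMonoOn.strictConvexOn_of_deriv (convex_Ioi 0) ?_ ?_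
  · exact continuousOn_id.rpow_const fun u hu => Or.inl (ne_of_gt hu)
  · rw [interior_Ioi]
    intro a ha b hb hab
    have ha : 0 < a := ha
    have hb : 0 < b := hb
    rw [Real.deriv_rpow_const, Real.deriv_rpow_const]
    exact mul_lt_mul_of_neg_left (Real.rpow_lt_rpow_of_neg ha hab (by linarith)) hq

lemma gap_weight_identity {m h g H : ℝ} (hh : 0 < h) (hg : 0 < g) :
    h / H * (g / h) ^ (1 - m) = H⁻¹ * (h ^ m * g ^ (1 - m)) := by
  rw [Real.div_rpow hg.le hh.le, Real.rpow_sub hh, Real.rpow_one]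
  have : 0 < h ^ m := Real.rpow_pos_of_pos hh m
  field_simp

/-- Jensen's inequality for u ↦ u^{1-m} at the quotients (gap of x)/(gap of v), with weights (gap of
v)/(v_j - v_i): the barycentre is (x_j - x_i)/(v_j - v_i). Strict convexity makes it strict as soon
as two quotients differ. -/
lemma rpow_dist_le {m : ℝ} (hm : 1 < m) {n : ℕ} {x v : ℕ → ℝ}
    (hx : StrictMonoOn x (Set.Iio n)) (hv : StrictMonoOn v (Set.Iio n)) {i j : ℕ} (hij : i < j)
    (hj : j < n) :
    (x j - x i) ^ (1 - m) ≤ ∑ k ∈ Finset.Ico i j,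
        (v j - v i) ^ (-m) * ((v (k + 1) - v k) ^ m * (x (k + 1) - x k) ^ (1 - m)) ∧
    ((∃ k ∈ Finset.Ico i j, ∃ k' ∈ Finset.Ico i j,
        (x (k + 1) - x k) / (v (k + 1) - v k) ≠ (x (k' + 1) - x k') / (v (k' + 1) - v k')) →
      (x j - x i) ^ (1 - m) < ∑ k ∈ Finset.Ico i j,
        (v j - v i) ^ (-m) * ((v (k + 1) - v k) ^ m * (x (k + 1) - x k) ^ (1 - m))) := by
  have hv' : ∀ k ∈ Finset.Ico i j, 0 < v (k + 1) - v k := fun k hk => by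
    rw [Finset.mem_Ico] at hk
    exact sub_pos.2 (hv (Set.mem_Iio.2 (by omega)) (Set.mem_Iio.2 (by omega)) (Nat.lt_succ_self k))
  have hx' : ∀ k ∈ Finset.Ico i j, 0 < x (k + 1) - x k := fun k hk => by
    rw [Finset.mem_Ico] at hk
    exact sub_pos.2 (hx (Set.mem_Iio.2 (by omega)) (Set.mem_Iio.2 (by omega)) (Nat.lt_succ_self k))
  have hG : 0 < x j - x i :=
    sub_pos.2 (hx (Set.mem_Iio.2 (by omega)) (Set.mem_Iio.2 (by omega)) hij)
  have hH : 0 < v j - v i :=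
    sub_pos.2 (hv (Set.mem_Iio.2 (by omega)) (Set.mem_Iio.2 (by omega)) hij)
  set H := v j - v i with hHdef
  have hsc := strictConvexOn_rpow_of_neg (q := 1 - m) (by linarith)
  have h0 : ∀ k ∈ Finset.Ico i j, 0 < (v (k + 1) - v k) / H := fun k hk => div_pos (hv' k hk) hH
  have h1 : ∑ k ∈ Finset.Ico i j, (v (k + 1) - v k) / H = 1 := by
    rw [← Finset.sum_div, Finset.sum_Ico_sub v hij.le, div_self hH.ne']
  have h2 : ∀ k ∈ Finset.Ico i j,
      (x (k + 1) - x k) / (v (k + 1) - v k) ∈ Set.Ioi (0 : ℝ) :=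
    fun k hk => div_pos (hx' k hk) (hv' k hk)
  have e1 : ∑ k ∈ Finset.Ico i j, ((v (k + 1) - v k) / H) •
      ((x (k + 1) - x k) / (v (k + 1) - v k)) = (x j - x i) / H := by
    rw [← Finset.sum_Ico_sub x hij.le, Finset.sum_div]
    refine Finset.sum_congr rfl fun k hk => ?_
    have := (hv' k hk).ne'
    rw [smul_eq_mul]
    field_simp
  have e2 : ∑ k ∈ Finset.Ico i j, ((v (k + 1) - v k) / H) •
      ((x (k + 1) - x k) / (v (k + 1) - v k)) ^ (1 - m) =
      H⁻¹ * ∑ k ∈ Finset.Ico i j, (v (k + 1) - v k) ^ m * (x (k + 1) - x k) ^ (1 - m) := by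
    rw [Finset.mul_sum]
    exact Finset.sum_congr rfl fun k hk => gap_weight_identity (hv' k hk) (hx' k hk)
  have hHm : 0 < H ^ (1 - m) := Real.rpow_pos_of_pos hH _
  have e3 : H ^ (-m) = H ^ (1 - m) * H⁻¹ := by
    rw [← Real.rpow_neg_one, ← Real.rpow_add hH]; ring_nf
  have e4 : (x j - x i) ^ (1 - m) = H ^ (1 - m) * ((x j - x i) / H) ^ (1 - m) := by
    rw [← Real.mul_rpow hH.le (div_pos hG hH).le, mul_div_cancel₀ _ hH.ne']
  rw [← Finset.mul_sum, e3, e4, mul_assoc]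
  constructor
  · refine mul_le_mul_of_nonneg_left ?_ hHm.le
    have := hsc.convexOn.map_sum_le (fun k hk => (h0 k hk).le) h1 h2
    rwa [e1, e2] at this
  · intro hne
    refine mul_lt_mul_of_pos_left ?_ hHm
    have := hsc.map_sum_lt h0 h1 h2 hne
    rwa [e1, e2] at this

lemma sum_pairs_gaps (f : ℕ → ℕ → ℕ → ℝ) (n : ℕ) :
    ∑ j ∈ Finset.range n, ∑ i ∈ Finset.range j, ∑ k ∈ Finset.Ico i j, f j i k =
      ∑ k ∈ Finset.range (n - 1), ∑ i ∈ Finset.range (k + 1), ∑ j ∈ Finset.Ico (k + 1) n,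
        f j i k := by
  have h1 : ∀ j, ∑ i ∈ Finset.range j, ∑ k ∈ Finset.Ico i j, f j i k =
      ∑ k ∈ Finset.range j, ∑ i ∈ Finset.range (k + 1), f j i k := fun j =>
    Finset.sum_comm' fun i k => by simp only [Finset.mem_range, Finset.mem_Ico]; omega
  simp only [h1]
  rw [Finset.sum_comm' (t' := Finset.range (n - 1)) (s' := fun k => Finset.Ico (k + 1) n)]
  · exact Finset.sum_congr rfl fun k _ => Finset.sum_comm
  · intro j k; simp only [Finset.mem_range, Finset.mem_Ico]; omega

/-- The gap k is crossed exactly by the pairs i ≤ k < j, whose coefficients add up to `seqCross`. -/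
lemma sum_pairs_gaps_eq_cross (m : ℝ) (x v : ℕ → ℝ) (n : ℕ) :
    ∑ j ∈ Finset.range n, ∑ i ∈ Finset.range j, ∑ k ∈ Finset.Ico i j,
        (v j - v i) ^ (-m) * ((v (k + 1) - v k) ^ m * (x (k + 1) - x k) ^ (1 - m)) =
      ∑ k ∈ Finset.range (n - 1),
        seqCross m v n k * ((v (k + 1) - v k) ^ m * (x (k + 1) - x k) ^ (1 - m)) := by
  rw [sum_pairs_gaps]
  simp only [seqCross, Finset.sum_mul]

/-- `V` is a subsolution of the equations of the critical points of the energy. -/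
def IsCertificate (m χ : ℝ) (v : ℕ → ℝ) (n : ℕ) : Prop :=
  StrictMonoOn v (Set.Iio n) ∧
    ∀ k < n - 1, 2 * χ * seqCross m v n k ≤ (v (k + 1) - v k) ^ (-m)

lemma IsCertificate.sum_le {m χ : ℝ} {n : ℕ} {x v : ℕ → ℝ}
    (hx : StrictMonoOn x (Set.Iio n)) (hv : IsCertificate m χ v n) :
    2 * χ * ∑ k ∈ Finset.range (n - 1),
        seqCross m v n k * ((v (k + 1) - v k) ^ m * (x (k + 1) - x k) ^ (1 - m)) ≤
      seqGap m x n := by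
  rw [Finset.mul_sum]
  refine Finset.sum_le_sum fun k hk => ?_
  rw [Finset.mem_range] at hk
  have h1 : 0 < v (k + 1) - v k :=
    sub_pos.2 (hv.1 (Set.mem_Iio.2 (by omega)) (Set.mem_Iio.2 (by omega)) (Nat.lt_succ_self k))
  have h2 : 0 < x (k + 1) - x k :=
    sub_pos.2 (hx (Set.mem_Iio.2 (by omega)) (Set.mem_Iio.2 (by omega)) (Nat.lt_succ_self k))
  have h3 := hv.2 k hk
  have h4 : 0 < (v (k + 1) - v k) ^ m := Real.rpow_pos_of_pos h1 _
  have h5 : 0 < (x (k + 1) - x k) ^ (1 - m) := Real.rpow_pos_of_pos h2 _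
  rw [← mul_assoc]
  calc _ ≤ (v (k + 1) - v k) ^ (-m) * ((v (k + 1) - v k) ^ m * (x (k + 1) - x k) ^ (1 - m)) :=
        mul_le_mul_of_nonneg_right h3 (by positivity)
    _ = _ := by rw [← mul_assoc, ← Real.rpow_add h1]; simp

/-- Sum the Jensen inequalities over all pairs and regroup by gaps: the certificate bounds each
coefficient. So a single v controls every x, like a dual witness. -/
lemma IsCertificate.pair_le_gap {m χ : ℝ} (hm : 1 < m) (hχ : 0 ≤ χ) {n : ℕ} {x v : ℕ → ℝ}
    (hx : StrictMonoOn x (Set.Iio n)) (hv : IsCertificate m χ v n) :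
    2 * χ * seqPair m x n ≤ seqGap m x n := by
  refine le_trans (mul_le_mul_of_nonneg_left ?_ (by positivity)) (hv.sum_le hx)
  rw [← sum_pairs_gaps_eq_cross, seqPair]
  refine Finset.sum_le_sum fun j hj => Finset.sum_le_sum fun i hi => ?_
  rw [Finset.mem_range] at hi hj
  exact (rpow_dist_le hm hx hv.1 hi hj).1

lemma IsCertificate.pair_lt_gap {m χ : ℝ} (hm : 1 < m) (hχ : 0 < χ) {n : ℕ} {x v : ℕ → ℝ}
    (hx : StrictMonoOn x (Set.Iio n)) (hv : IsCertificate m χ v n)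
    (hne : ∃ k < n - 1, ∃ k' < n - 1,
      (x (k + 1) - x k) / (v (k + 1) - v k) ≠ (x (k' + 1) - x k') / (v (k' + 1) - v k')) :
    2 * χ * seqPair m x n < seqGap m x n := by
  refine lt_of_lt_of_le (mul_lt_mul_of_pos_left ?_ (by positivity)) (hv.sum_le hx)
  rw [← sum_pairs_gaps_eq_cross, seqPair]
  obtain ⟨k, hk, k', hk', hne⟩ := hne
  -- The extreme pair (0, n - 1) spans all the gaps, so Jensen is strict there whichever two
  -- quotients differ.
  refine Finset.sum_lt_sum (fun j hj => Finset.sum_le_sum fun i hi => ?_)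
    ⟨n - 1, by rw [Finset.mem_range]; omega, Finset.sum_lt_sum (fun i hi => ?_)
      ⟨0, by rw [Finset.mem_range]; omega, ?_⟩⟩
  · rw [Finset.mem_range] at hi hj
    exact (rpow_dist_le hm hx hv.1 hi hj).1
  · rw [Finset.mem_range] at hi
    exact (rpow_dist_le hm hx hv.1 hi (by omega)).1
  · refine (rpow_dist_le hm hx hv.1 (by omega) (by omega)).2 ⟨k, ?_, k', ?_, hne⟩ <;>
    rw [Finset.mem_Ico] <;> omega

/-- A solution in `n'` particles, restricted to its first `n < n'` particles,
is a strict certificate. -/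
lemma IsCertificate.exists_larger_of_truncate {m χ : ℝ} (hχ : 0 < χ) {n n' : ℕ} (hn : n < n')
    {v : ℕ → ℝ} (hv : IsCertificate m χ v n') : ∃ χ' > χ, IsCertificate m χ' v n := by
  have hmono : StrictMonoOn v (Set.Iio n) := hv.1.mono (Set.Iio_subset_Iio hn.le)
  have hlt : ∀ k ∈ Finset.range (n - 1),
      2 * χ * seqCross m v n k < (v (k + 1) - v k) ^ (-m) := fun k hk => by
    rw [Finset.mem_range] at hk
    refine lt_of_lt_of_le (mul_lt_mul_of_pos_left ?_ (by positivity)) (hv.2 k (by omega))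
    refine Finset.sum_lt_sum_of_nonempty (by simp) fun i hi => ?_
    rw [Finset.mem_range] at hi
    -- The dropped particle n contributes a positive term to the attraction across every remaining
    -- gap.
    refine Finset.sum_lt_sum_of_subset (i := n) (Finset.Ico_subset_Ico_right hn.le)
      (by rw [Finset.mem_Ico]; omega) (by simp) ?_ ?_
    · exact Real.rpow_pos_of_pos
        (sub_pos.2 (hv.1 (Set.mem_Iio.2 (by omega)) (Set.mem_Iio.2 (by omega)) (by omega))) _
    · intro j hj _
      rw [Finset.mem_Ico] at hj
      exact (Real.rpow_pos_of_pos
        (sub_pos.2 (hv.1 (Set.mem_Iio.2 (by omega)) (Set.mem_Iio.2 (by omega)) (by omega))) _).le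
  -- Finitely many strict inequalities survive a small increase of χ.
  have hev : ∀ᶠ χ' in 𝓝[>] χ, ∀ k ∈ Finset.range (n - 1),
      2 * χ' * seqCross m v n k < (v (k + 1) - v k) ^ (-m) := by
    rw [Finset.eventually_all]
    intro k hk
    have : ContinuousAt (fun χ' : ℝ => 2 * χ' * seqCross m v n k) χ := by fun_prop
    exact (this.eventually_lt_const (hlt k hk)).filter_mono nhdsWithin_le_nhds
  obtain ⟨χ', h1, h2⟩ := (hev.and self_mem_nhdsWithin).exists
  exact ⟨χ', h2, hmono, fun k hk => (h1 k (Finset.mem_range.2 hk)).le⟩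

/-- Charge the pair (i, j) to the gap i, which is no longer than the pair's distance; each gap is
charged at most n - 1 times. -/
lemma seqPair_le {m : ℝ} (hm : 1 < m) {n : ℕ} {x : ℕ → ℝ} (hx : StrictMonoOn x (Set.Iio n)) :
    seqPair m x n ≤ (n - 1 : ℕ) * seqGap m x n := by
  have h : ∀ j ∈ Finset.range n, ∑ i ∈ Finset.range j, (x j - x i) ^ (1 - m) ≤
      ∑ i ∈ Finset.range (n - 1), if i < j then (x (i + 1) - x i) ^ (1 - m) else 0 := fun j hj => by
    rw [Finset.mem_range] at hj
    rw [← Finset.sum_filter]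
    have : (Finset.range (n - 1)).filter (fun i => i < j) = Finset.range j := by
      ext i; simp; omega
    rw [this]
    refine Finset.sum_le_sum fun i hi => ?_
    rw [Finset.mem_range] at hi
    refine Real.rpow_le_rpow_of_nonpos (sub_pos.2 (hx (Set.mem_Iio.2 (by omega))
      (Set.mem_Iio.2 (by omega)) (Nat.lt_succ_self i))) (sub_le_sub_right ?_ _) (by linarith)
    exact hx.monotoneOn (Set.mem_Iio.2 (by omega)) (Set.mem_Iio.2 (by omega)) hi
  refine (Finset.sum_le_sum h).trans ?_
  rw [Finset.sum_comm, seqGap, Finset.mul_sum]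
  refine Finset.sum_le_sum fun i hi => ?_
  rw [Finset.mem_range] at hi
  rw [← Finset.sum_filter, Finset.sum_const, nsmul_eq_mul]
  have h1 : 0 < x (i + 1) - x i := sub_pos.2 (hx (Set.mem_Iio.2 (by omega))
      (Set.mem_Iio.2 (by omega)) (Nat.lt_succ_self i))
  refine mul_le_mul_of_nonneg_right ?_ (Real.rpow_pos_of_pos h1 _).le
  have : (Finset.range n).filter (fun j => i < j) = Finset.Ico (i + 1) n := by
    ext j; simp; omega
  rw [this, Nat.card_Ico]
  exact_mod_cast (by omega : n - (i + 1) ≤ n - 1)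

/-- Adding a particle at a large distance makes a nonpositive energy negative. -/
lemma exists_add_particle {m χ : ℝ} (hm : 1 < m) {n : ℕ} (hn : 1 ≤ n)
    (hχ : 1 < 2 * n * χ) {x : ℕ → ℝ} (hx : StrictMonoOn x (Set.Iio n))
    (hle : seqGap m x n ≤ 2 * χ * seqPair m x n) :
    ∃ y : ℕ → ℝ, StrictMonoOn y (Set.Iio (n + 1)) ∧
      seqGap m y (n + 1) < 2 * χ * seqPair m y (n + 1) := by
  have hχ0 : 0 < χ := by
    by_contra h
    have : 2 * n * χ ≤ 0 := mul_nonpos_of_nonneg_of_nonpos (by positivity) (not_lt.1 h)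
    linarith
  set D := x (n - 1) - x 0 with hD
  have hD0 : 0 ≤ D := sub_nonneg.2 (hx.monotoneOn (Set.mem_Iio.2 (by omega))
    (Set.mem_Iio.2 (by omega)) (Nat.zero_le _))
  -- A particle placed at distance L to the right costs L^{1-m} and gains at least 2nχ(D + L)^{1-m};
  -- the ratio of gain to cost tends to 2nχ > 1.
  have hlim : Tendsto (fun L : ℝ => 2 * n * χ * (1 + D / L) ^ (1 - m)) atTop
      (𝓝 (2 * n * χ * (1 + 0) ^ (1 - m))) := by
    refine Tendsto.const_mul _ (Tendsto.rpow_const ?_ (Or.inl (by norm_num)))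
    exact tendsto_const_nhds.add (tendsto_const_nhds.div_atTop tendsto_id)
  rw [add_zero, Real.one_rpow, mul_one] at hlim
  obtain ⟨L, hL1, hL0⟩ :=
    ((hlim.eventually_const_lt hχ).and (eventually_gt_atTop 0)).exists
  have hmain : L ^ (1 - m) < 2 * χ * (n * (D + L) ^ (1 - m)) := by
    have : (D + L) ^ (1 - m) = L ^ (1 - m) * (1 + D / L) ^ (1 - m) := by
      rw [← Real.mul_rpow hL0.le (by positivity)]
      congr 1
      field_simp
      ring
    rw [this]
    nlinarith [Real.rpow_pos_of_pos hL0 (1 - m)]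
  set y : ℕ → ℝ := fun i => if i < n then x i else x (n - 1) + L with hy
  have hyx : ∀ i < n, y i = x i := fun i hi => by simp [hy, hi]
  have hyn : y n = x (n - 1) + L := by simp [hy]
  have hxle : ∀ i < n, x i ≤ x (n - 1) := fun i hi =>
    hx.monotoneOn (Set.mem_Iio.2 (by omega)) (Set.mem_Iio.2 (by omega)) (by omega)
  refine ⟨y, ?_, ?_⟩
  · intro i hi j hj hij
    rw [Set.mem_Iio] at hi hj
    rw [hyx i (by omega)]
    by_cases h : j < n
    · rw [hyx j h]
      exact hx (Set.mem_Iio.2 (by omega)) (Set.mem_Iio.2 (by omega)) hij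
    · rw [show j = n by omega, hyn]
      linarith [hxle i (by omega)]
  · have hg : seqGap m y (n + 1) = seqGap m x n + L ^ (1 - m) := by
      rw [seqGap, seqGap, show n + 1 - 1 = (n - 1) + 1 by omega, Finset.sum_range_succ]
      congr 1
      · refine Finset.sum_congr rfl fun k hk => ?_
        rw [Finset.mem_range] at hk
        rw [hyx _ (by omega), hyx _ (by omega)]
      · rw [show n - 1 + 1 = n by omega, hyn, hyx _ (by omega)]
        simp
    have hp : seqPair m x n + n * (D + L) ^ (1 - m) ≤ seqPair m y (n + 1) := by
      rw [seqPair, seqPair, Finset.sum_range_succ]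
      refine add_le_add (le_of_eq ?_) ?_
      · refine Finset.sum_congr rfl fun j hj => Finset.sum_congr rfl fun i hi => ?_
        rw [Finset.mem_range] at hi hj
        rw [hyx _ (by omega), hyx _ (by omega)]
      · have : ∑ _i ∈ Finset.range n, (D + L) ^ (1 - m) = n * (D + L) ^ (1 - m) := by simp
        rw [← this]
        refine Finset.sum_le_sum fun i hi => ?_
        rw [Finset.mem_range] at hi
        rw [hyn, hyx i hi]
        have h0 : x 0 ≤ x i := hx.monotoneOn (Set.mem_Iio.2 (by omega))
          (Set.mem_Iio.2 (by omega)) (Nat.zero_le _)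
        exact Real.rpow_le_rpow_of_nonpos (by linarith [hxle i hi]) (by linarith) (by linarith)
    rw [hg]
    have := mul_le_mul_of_nonneg_left hp (by positivity : 0 ≤ 2 * χ)
    linarith

lemma exists_add_particles {m χ : ℝ} (hm : 1 < m) {n n' : ℕ} (hn : 1 ≤ n) (hnn : n < n')
    (hχ : 1 < 2 * n * χ) {x : ℕ → ℝ} (hx : StrictMonoOn x (Set.Iio n))
    (hle : seqGap m x n ≤ 2 * χ * seqPair m x n) :
    ∃ y : ℕ → ℝ, StrictMonoOn y (Set.Iio n') ∧ seqGap m y n' < 2 * χ * seqPair m y n' := by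
  induction n', hnn using Nat.le_induction with
  | base => exact exists_add_particle hm hn hχ hx hle
  | succ q hq ih =>
    obtain ⟨y, hy, hlt⟩ := ih
    have hχ0 : 0 < χ := by
      by_contra h
      have : 2 * n * χ ≤ 0 := mul_nonpos_of_nonneg_of_nonpos (by positivity) (not_lt.1 h)
      linarith
    refine exists_add_particle hm (by omega) (lt_of_lt_of_le hχ ?_) hy hlt.le
    have : (n : ℝ) ≤ q := by exact_mod_cast (by omega : n ≤ q)
    gcongr

/-! ### Translation between configurations and sequences; the thresholds. -/

/-- The positions of the particles as a sequence, extended by `0`. -/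
def toSeq {N : ℕ} (X : Config N) (i : ℕ) : ℝ := if h : i < N then X ⟨i, h⟩ else 0

@[simp] lemma toSeq_val {N : ℕ} (X : Config N) (i : Fin N) : toSeq X i = X i := by simp [toSeq]

lemma toSeq_of_lt {N : ℕ} (X : Config N) {i : ℕ} (hi : i < N) : toSeq X i = X ⟨i, hi⟩ := by
  simp [toSeq, hi]

lemma toSeq_sub {N : ℕ} (X : Config N) (k : Fin (N - 1)) :
    toSeq X (k + 1) - toSeq X k = gap X k := by
  rw [toSeq_of_lt X (show (k : ℕ) + 1 < N by omega), toSeq_of_lt X (show (k : ℕ) < N by omega), gap]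

lemma strictMonoOn_toSeq {N : ℕ} {X : Config N} (hX : ∀ i j : Fin N, i < j → X i < X j) :
    StrictMonoOn (toSeq X) (Set.Iio N) := by
  intro i hi j hj hij
  rw [toSeq_of_lt X hi, toSeq_of_lt X hj]
  exact hX _ _ hij

lemma gapSum_eq_seqGap (m : ℝ) {N : ℕ} (X : Config N) : gapSum m X = seqGap m (toSeq X) N := by
  rw [gapSum, seqGap, Finset.sum_range]
  simp only [toSeq_sub]

lemma sum_offDiag_eq_two_mul {N : ℕ} {f : ℕ → ℕ → ℝ} (hf : ∀ i j, f i j = f j i) :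
    ∑ i : Fin N, ∑ j : Fin N with j ≠ i, f i j =
      2 * ∑ j ∈ Finset.range N, ∑ i ∈ Finset.range j, f i j := by
  have h1 : ∑ i : Fin N, ∑ j : Fin N with j ≠ i, f i j =
      ∑ i ∈ Finset.range N, ∑ j ∈ Finset.range N, if j ≠ i then f i j else 0 := by
    rw [Finset.sum_range]
    refine Finset.sum_congr rfl fun i _ => ?_
    rw [Finset.sum_filter, Finset.sum_range]
    simp only [ne_eq, Fin.ext_iff]
  have h2 : ∑ j ∈ Finset.range N, ∑ i ∈ Finset.range j, f i j =
      ∑ j ∈ Finset.range N, ∑ i ∈ Finset.range N, if i < j then f i j else 0 := by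
    refine Finset.sum_congr rfl fun j hj => ?_
    rw [Finset.mem_range] at hj
    rw [← Finset.sum_filter]
    congr 1
    ext i; simp; omega
  rw [h1, h2, two_mul]
  nth_rewrite 2 [Finset.sum_comm]
  rw [← Finset.sum_add_distrib]
  refine Finset.sum_congr rfl fun i _ => ?_
  rw [← Finset.sum_add_distrib]
  refine Finset.sum_congr rfl fun j _ => ?_
  rcases lt_trichotomy i j with h | h | h
  · simp [h, h.ne', not_lt.2 h.le]
  · simp [h]
  · simp [h, h.ne, not_lt.2 h.le, hf i j]

lemma pairSum_eq_seqPair (m : ℝ) {N : ℕ} {X : Config N}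
    (hX : ∀ i j : Fin N, i < j → X i < X j) : pairSum m X = 2 * seqPair m (toSeq X) N := by
  have h := sum_offDiag_eq_two_mul (N := N) (f := fun i j => |toSeq X j - toSeq X i| ^ (1 - m))
    (fun i j => by rw [abs_sub_comm])
  simp only [toSeq_val] at h
  rw [pairSum, h, seqPair]
  congr 1
  refine Finset.sum_congr rfl fun j hj => Finset.sum_congr rfl fun i hi => ?_
  rw [Finset.mem_range] at hi hj
  rw [abs_of_pos]
  exact sub_pos.2 (strictMonoOn_toSeq hX (Set.mem_Iio.2 (by omega)) (Set.mem_Iio.2 hj) hi)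

/-- The total force exerted on the particles to the left of a gap. -/
lemma sum_velocity_left (m χ : ℝ) {N : ℕ} {X : Config N}
    (hX : ∀ i j : Fin N, i < j → X i < X j) (k : Fin (N - 1)) :
    ∑ i ∈ Finset.univ.filter (fun i : Fin N => (i : ℕ) ≤ k), velocity m χ X i =
      -gap X k ^ (-m) + 2 * χ * seqCross m (toSeq X) N k := by
  -- Test the weak form with the indicator of the left particles: it jumps only at the gap k, so
  -- only the pairs crossing this gap survive.
  set e : ℕ → ℝ := fun i => if i ≤ k then 1 else 0 with he
  have h := inner_velocity m χ (WithLp.toLp 2 fun i : Fin N => e i) X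
  have h1 : inner ℝ (velocity m χ X) (WithLp.toLp 2 fun i : Fin N => e i) =
      ∑ i ∈ Finset.univ.filter (fun i : Fin N => (i : ℕ) ≤ k), velocity m χ X i := by
    simp [PiLp.inner_apply, he, Finset.sum_filter]
  have h2 : ∑ k' : Fin (N - 1), gap X k' ^ (-m) *
      gap (WithLp.toLp 2 fun i : Fin N => e i) k' = - gap X k ^ (-m) := by
    rw [Finset.sum_eq_single k]
    · simp [gap, he]
    · intro b _ hb
      have hb : (b : ℕ) ≠ k := fun h => hb (Fin.ext h)
      have : gap (WithLp.toLp 2 fun i : Fin N => e i) b = 0 := by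
        simp only [gap, he]
        by_cases h3 : (b : ℕ) ≤ k
        · rw [if_pos h3, if_pos (by omega), sub_self]
        · rw [if_neg h3, if_neg (by omega), sub_self]
      rw [this, mul_zero]
    · simp
  have h3 := sum_offDiag_eq_two_mul (N := N)
    (f := fun i j => ((Int.sign ((j : ℤ) - (i : ℤ)) : ℤ) : ℝ) * (e j - e i) *
      |toSeq X j - toSeq X i| ^ (-m)) (fun i j => by
        rw [abs_sub_comm, show ((j : ℤ) - (i : ℤ)) = -((i : ℤ) - (j : ℤ)) by ring, Int.sign_neg]
        push_cast
        ring)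
  simp only [toSeq_val] at h3
  have h4 : ∑ j ∈ Finset.range N, ∑ i ∈ Finset.range j,
      ((Int.sign ((j : ℤ) - (i : ℤ)) : ℤ) : ℝ) * (e j - e i) *
      |toSeq X j - toSeq X i| ^ (-m) = - seqCross m (toSeq X) N k := by
    have h5 : seqCross m (toSeq X) N k = ∑ j ∈ Finset.range N, ∑ i ∈ Finset.range j,
        if i ≤ k ∧ ↑k < j then (toSeq X j - toSeq X i) ^ (-m) else 0 := by
      rw [seqCross]
      simp only [← Finset.sum_filter]
      refine Finset.sum_comm' fun i j => ?_
      simp only [Finset.mem_range, Finset.mem_Ico, Finset.mem_filter]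
      omega
    rw [h5, ← Finset.sum_neg_distrib]
    refine Finset.sum_congr rfl fun j hj => ?_
    rw [← Finset.sum_neg_distrib]
    refine Finset.sum_congr rfl fun i hi => ?_
    rw [Finset.mem_range] at hi hj
    have hpos : 0 < toSeq X j - toSeq X i :=
      sub_pos.2 (strictMonoOn_toSeq hX (Set.mem_Iio.2 (by omega)) (Set.mem_Iio.2 hj) hi)
    rw [Int.sign_eq_one_of_pos (by omega), abs_of_pos hpos, he]
    by_cases h6 : i ≤ k
    · by_cases h7 : (k : ℕ) < j
      · simp [h6, h7, not_le.2 h7]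
      · simp [h6, not_lt.1 h7, h7]
    · simp [h6, show ¬ j ≤ k by omega]
  rw [h1, h2] at h
  rw [h, h3, h4]
  ring

/-- The sequence `x` restricted to its first `n` terms, and centred. -/
def ofSeq (n : ℕ) (x : ℕ → ℝ) : Config n :=
  WithLp.toLp 2 fun i : Fin n => x i - (∑ j ∈ Finset.range n, x j) / n

lemma ofSeq_mem {n : ℕ} {x : ℕ → ℝ} (hx : StrictMonoOn x (Set.Iio n)) :
    ofSeq n x ∈ orderedConfigs n := by
  constructor
  · intro i j hij
    exact sub_lt_sub_right (hx i.2 j.2 hij) _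
  · rcases Nat.eq_zero_or_pos n with rfl | hn
    · simp
    · have : (n : ℝ) ≠ 0 := by positivity
      simp only [ofSeq, Finset.sum_sub_distrib, Finset.sum_const, Finset.card_univ,
        Fintype.card_fin, nsmul_eq_mul, Finset.sum_range]
      field_simp
      ring

lemma toSeq_ofSeq {n : ℕ} (x : ℕ → ℝ) {i : ℕ} (hi : i < n) :
    toSeq (ofSeq n x) i = x i - (∑ j ∈ Finset.range n, x j) / n := by
  rw [toSeq_of_lt _ hi]; rfl

lemma gapSum_ofSeq (m : ℝ) (n : ℕ) (x : ℕ → ℝ) : gapSum m (ofSeq n x) = seqGap m x n := by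
  rw [gapSum_eq_seqGap, seqGap, seqGap]
  refine Finset.sum_congr rfl fun k hk => ?_
  rw [Finset.mem_range] at hk
  rw [toSeq_ofSeq _ (by omega), toSeq_ofSeq _ (by omega)]
  congr 1
  ring

lemma pairSum_ofSeq (m : ℝ) {n : ℕ} {x : ℕ → ℝ} (hx : StrictMonoOn x (Set.Iio n)) :
    pairSum m (ofSeq n x) = 2 * seqPair m x n := by
  rw [pairSum_eq_seqPair m (ofSeq_mem hx).1, seqPair, seqPair]
  congr 1
  refine Finset.sum_congr rfl fun j hj => Finset.sum_congr rfl fun i hi => ?_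
  rw [Finset.mem_range] at hi hj
  rw [toSeq_ofSeq _ hj, toSeq_ofSeq _ (by omega)]
  congr 1
  ring

lemma gapSum_pos {m : ℝ} {N : ℕ} (hN : 2 ≤ N) {X : Config N}
    (hX : ∀ i j : Fin N, i < j → X i < X j) : 0 < gapSum m X :=
  Finset.sum_pos (fun k _ => Real.rpow_pos_of_pos (gap_pos hX k) _)
    ⟨⟨0, by omega⟩, Finset.mem_univ _⟩

lemma pairSum_pos {m : ℝ} {N : ℕ} (hN : 2 ≤ N) {X : Config N}
    (hX : ∀ i j : Fin N, i < j → X i < X j) : 0 < pairSum m X := by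
  rw [pairSum_eq_seqPair m hX, seqPair]
  have h0 : ∀ j ∈ Finset.range N, ∀ i ∈ Finset.range j,
      0 < (toSeq X j - toSeq X i) ^ (1 - m) := fun j hj i hi => by
    rw [Finset.mem_range] at hi hj
    exact Real.rpow_pos_of_pos
      (sub_pos.2 (strictMonoOn_toSeq hX (Set.mem_Iio.2 (by omega)) (Set.mem_Iio.2 hj) hi)) _
  refine mul_pos two_pos (Finset.sum_pos' (fun j hj => Finset.sum_nonneg fun i hi =>
    (h0 j hj i hi).le) ⟨1, by rw [Finset.mem_range]; omega, ?_⟩)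
  exact Finset.sum_pos (h0 1 (by rw [Finset.mem_range]; omega)) (by simp)

lemma orderedConfigs_nonempty (n : ℕ) : (orderedConfigs n).Nonempty :=
  ⟨ofSeq n fun i => (i : ℝ), ofSeq_mem fun _ _ _ _ h => Nat.cast_lt.2 h⟩

/-- Makes the `sSup` in `threshold` a genuine supremum rather than the default value 0. -/
lemma bddAbove_quotients {m : ℝ} (hm : 1 < m) {n : ℕ} (hn : 2 ≤ n) :
    BddAbove ((fun X : Config n => pairSum m X / gapSum m X) '' orderedConfigs n) := by
  refine ⟨2 * (n - 1 : ℕ), ?_⟩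
  rintro _ ⟨X, hX, rfl⟩
  simp only
  rw [div_le_iff₀ (gapSum_pos hn hX.1), pairSum_eq_seqPair m hX.1, gapSum_eq_seqGap, mul_assoc]
  exact mul_le_mul_of_nonneg_left (seqPair_le hm (strictMonoOn_toSeq hX.1)) two_pos.le

lemma sSup_quotients_pos {m : ℝ} (hm : 1 < m) {n : ℕ} (hn : 2 ≤ n) :
    0 < sSup ((fun X : Config n => pairSum m X / gapSum m X) '' orderedConfigs n) := by
  obtain ⟨X, hX⟩ := orderedConfigs_nonempty n
  exact lt_of_lt_of_le (div_pos (pairSum_pos hn hX.1) (gapSum_pos hn hX.1))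
    (le_csSup (bddAbove_quotients hm hn) ⟨X, hX, rfl⟩)

lemma threshold_pos {m : ℝ} (hm : 1 < m) {n : ℕ} (hn : 2 ≤ n) : 0 < threshold m n :=
  inv_pos.2 (sSup_quotients_pos hm hn)

lemma threshold_mul_pairSum_le {m : ℝ} (hm : 1 < m) {n : ℕ} (hn : 2 ≤ n) {X : Config n}
    (hX : X ∈ orderedConfigs n) : threshold m n * pairSum m X ≤ gapSum m X := by
  have h := le_csSup (bddAbove_quotients hm hn) ⟨X, hX, rfl⟩
  simp only at h
  rw [div_le_iff₀ (gapSum_pos hn hX.1)] at h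
  rw [threshold, inv_mul_le_iff₀ (sSup_quotients_pos hm hn)]
  exact h

lemma le_threshold {m χ : ℝ} (hm : 1 < m) (hχ : 0 < χ) {n : ℕ} (hn : 2 ≤ n)
    (h : ∀ x : ℕ → ℝ, StrictMonoOn x (Set.Iio n) → 2 * χ * seqPair m x n ≤ seqGap m x n) :
    χ ≤ threshold m n := by
  rw [threshold, le_inv_comm₀ hχ (sSup_quotients_pos hm hn)]
  refine csSup_le ((orderedConfigs_nonempty n).image _) ?_
  rintro _ ⟨X, hX, rfl⟩
  simp only
  rw [div_le_iff₀ (gapSum_pos hn hX.1), ← div_eq_inv_mul, le_div_iff₀ hχ,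
    pairSum_eq_seqPair m hX.1, gapSum_eq_seqGap]
  linarith [h _ (strictMonoOn_toSeq hX.1)]

lemma threshold_mul_seqPair_le {m : ℝ} (hm : 1 < m) {n : ℕ} (hn : 2 ≤ n) {x : ℕ → ℝ}
    (hx : StrictMonoOn x (Set.Iio n)) :
    2 * threshold m n * seqPair m x n ≤ seqGap m x n := by
  have := threshold_mul_pairSum_le hm hn (ofSeq_mem hx)
  rw [pairSum_ofSeq m hx, gapSum_ofSeq] at this
  linarith

lemma IsCertificate.le_threshold {m χ : ℝ} (hm : 1 < m) (hχ : 0 < χ) {n : ℕ} (hn : 2 ≤ n)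
    {v : ℕ → ℝ} (hv : IsCertificate m χ v n) : χ ≤ threshold m n :=
  ParticleFlow.le_threshold hm hχ hn fun _ hx => hv.pair_le_gap hm hχ.le hx

/-! ### Rigidity of critical points. -/

/-- By `sum_velocity_left`, the certificate inequality at a gap says precisely that the total force
to the left of it is nonpositive. -/
lemma isCertificate_of_velocity {m χ : ℝ} {N : ℕ} {X : Config N}
    (hX : ∀ i j : Fin N, i < j → X i < X j)
    (h : ∀ k : Fin (N - 1),
      ∑ i ∈ Finset.univ.filter (fun i : Fin N => (i : ℕ) ≤ k), velocity m χ X i ≤ 0) :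
    IsCertificate m χ (toSeq X) N := by
  refine ⟨strictMonoOn_toSeq hX, fun k hk => ?_⟩
  have := h ⟨k, hk⟩
  rw [sum_velocity_left m χ hX] at this
  rw [show toSeq X (k + 1) - toSeq X k = gap X ⟨k, hk⟩ from toSeq_sub X ⟨k, hk⟩]
  simp only at this
  linarith

lemma isCertificate_of_velocity_eq_zero {m χ : ℝ} {N : ℕ} {X : Config N}
    (hX : ∀ i j : Fin N, i < j → X i < X j) (h : velocity m χ X = 0) :
    IsCertificate m χ (toSeq X) N :=
  isCertificate_of_velocity hX fun k => by simp [h]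

lemma energy_eq_zero {m χ : ℝ} (hm : 1 < m) {N : ℕ} {X : Config N}
    (hX : ∀ i j : Fin N, i < j → X i < X j) (h : velocity m χ X = 0) :
    seqGap m (toSeq X) N = 2 * χ * seqPair m (toSeq X) N := by
  have h1 := inner_velocity_self (χ := χ) hm hX
  have hm' : m - 1 ≠ 0 := by linarith
  rw [h, inner_zero_left, energy, pairSum_eq_seqPair m hX, gapSum_eq_seqGap] at h1
  field_simp at h1
  linarith

/-- If the energy of `p` particles has a critical point, then `χ` is the threshold `C_p`. -/
lemma eq_threshold_of_critical {m χ : ℝ} (hm : 1 < m) (hχ : 0 < χ) {p : ℕ} (hp : 2 ≤ p)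
    {V : Config p} (hV : V ∈ orderedConfigs p) (h : velocity m χ V = 0) :
    χ = threshold m p := by
  refine le_antisymm ((isCertificate_of_velocity_eq_zero hV.1 h).le_threshold hm hχ hp) ?_
  -- Zero energy makes the quotient at V equal to 1/χ, which bounds the supremum from below.
  have h1 := energy_eq_zero hm hV.1 h
  have h2 := threshold_mul_pairSum_le hm hp hV
  have h3 := pairSum_pos (m := m) hp hV.1
  rw [gapSum_eq_seqGap, h1, mul_assoc, mul_left_comm, ← pairSum_eq_seqPair m hV.1] at h2
  exact le_of_mul_le_mul_right h2 h3

/-- The first q particles of V no longer feel the others, and so form a certificate for some larger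
coefficient. -/
lemma threshold_gt_of_critical {m χ : ℝ} (hm : 1 < m) (hχ : 0 < χ) {p q : ℕ} (hq : 2 ≤ q)
    (hqp : q < p) {V : Config p} (hV : V ∈ orderedConfigs p) (h : velocity m χ V = 0) :
    χ < threshold m q := by
  obtain ⟨χ', h1, h2⟩ :=
    (isCertificate_of_velocity_eq_zero hV.1 h).exists_larger_of_truncate hχ hqp
  exact lt_of_lt_of_le h1 (h2.le_threshold hm (hχ.trans h1) hq)

/-- V has zero energy; adding distant particles makes it negative, which would be impossible for χ ≤
C_q. -/
lemma threshold_lt_of_critical {m χ : ℝ} (hm : 1 < m) (hχ : 0 < χ) {p q : ℕ} (hp : 2 ≤ p)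
    (hpq : p < q) {V : Config p} (hV : V ∈ orderedConfigs p) (h : velocity m χ V = 0) :
    threshold m q < χ := by
  have h1 := energy_eq_zero hm hV.1 h
  have hgap := gapSum_pos (m := m) hp hV.1
  rw [gapSum_eq_seqGap] at hgap
  -- Zero energy and `seqPair_le` give 1 ≤ 2χ(p - 1), hence the condition for a distant particle to
  -- lower the energy.
  have h2 : 1 < 2 * p * χ := by
    have h3 := seqPair_le hm (strictMonoOn_toSeq hV.1)
    have h4 : seqGap m (toSeq V) p * 1 ≤ seqGap m (toSeq V) p * (2 * χ * (p - 1 : ℕ)) := by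
      rw [mul_one]
      calc _ = 2 * χ * seqPair m (toSeq V) p := h1
        _ ≤ 2 * χ * ((p - 1 : ℕ) * seqGap m (toSeq V) p) :=
          mul_le_mul_of_nonneg_left h3 (by positivity)
        _ = _ := by ring
    have h5 := le_of_mul_le_mul_left h4 hgap
    rw [Nat.cast_sub (by omega)] at h5
    push_cast at h5
    nlinarith
  obtain ⟨y, hy, hlt⟩ := exists_add_particles hm (by omega) hpq h2 (strictMonoOn_toSeq hV.1) h1.le
  by_contra hcon
  have h6 := threshold_mul_seqPair_le hm (n := q) (by omega) hy
  have h7 : 0 ≤ seqPair m y q := Finset.sum_nonneg fun j hj => Finset.sum_nonneg fun i hi => by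
    rw [Finset.mem_range] at hi hj
    exact (Real.rpow_pos_of_pos (sub_pos.2 (hy (Set.mem_Iio.2 (by omega))
      (Set.mem_Iio.2 (by omega)) hi)) _).le
  nlinarith [mul_le_mul_of_nonneg_right (not_lt.1 hcon) h7]

/-- The number of particles of the critical points is determined by `χ`. -/
lemma card_eq_of_critical {m : ℝ} (hm : 1 < m) {p q : ℕ} (hp : 2 ≤ p) (hq : 2 ≤ q)
    {V : Config p} (hV : V ∈ orderedConfigs p) (h : velocity m (threshold m q) V = 0) : p = q := by
  have hχ := threshold_pos hm hq
  rcases lt_trichotomy p q with h1 | h1 | h1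
  · exact absurd (threshold_lt_of_critical hm hχ hp h1 hV h) (lt_irrefl _)
  · exact h1
  · exact absurd (threshold_gt_of_critical hm hχ hq h1 hV h) (lt_irrefl _)

lemma eq_of_gap_eq {N : ℕ} {X Y : Config N} (hX : ∑ i, X i = 0) (hY : ∑ i, Y i = 0)
    (h : ∀ k, gap X k = gap Y k) : X = Y := by
  obtain _ | n := N
  · ext i; exact i.elim0
  have h1 : ∀ i : ℕ, ∀ hi : i < n + 1, X ⟨i, hi⟩ - Y ⟨i, hi⟩ = X 0 - Y 0 := by
    intro i
    induction i with
    | zero => intro hi; rfl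
    | succ i ih =>
      intro hi
      have h2 := h ⟨i, by omega⟩
      simp only [gap] at h2
      linarith [ih (by omega)]
  have h2 : ∑ i : Fin (n + 1), (X i - Y i) = (n + 1) * (X 0 - Y 0) := by
    rw [Finset.sum_congr rfl fun (i : Fin (n + 1)) _ => h1 i i.2]
    simp [mul_sub]
  rw [Finset.sum_sub_distrib, hX, hY, sub_zero] at h2
  have h3 : X 0 - Y 0 = 0 := by
    rcases mul_eq_zero.1 h2.symm with h3 | h3
    · exact absurd h3 (by positivity)
    · exact h3
  ext i
  have := h1 i i.2
  rw [h3] at this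
  exact sub_eq_zero.1 this

/-- Critical points are unique up to dilation. -/
lemma critical_unique {m χ : ℝ} (hm : 1 < m) (hχ : 0 < χ) {p : ℕ} (hp : 2 ≤ p)
    {V W : Config p} (hV : V ∈ orderedConfigs p) (hV0 : velocity m χ V = 0)
    (hW : W ∈ orderedConfigs p) (hW0 : velocity m χ W = 0) : ∃ a : ℝ, 0 < a ∧ W = a • V := by
  have h1 := energy_eq_zero hm hW.1 hW0
  -- W has zero energy, so it is an equality case of the inequality certified by V.
  have h2 : ∀ k k' : Fin (p - 1), gap W k / gap V k = gap W k' / gap V k' := by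
    intro k k'
    by_contra hne
    refine absurd ((isCertificate_of_velocity_eq_zero hV.1 hV0).pair_lt_gap hm hχ
      (strictMonoOn_toSeq hW.1) ⟨k, k.2, k', k'.2, ?_⟩) (by rw [h1]; exact lt_irrefl _)
    simpa only [toSeq_sub] using hne
  refine ⟨gap W ⟨0, by omega⟩ / gap V ⟨0, by omega⟩,
    div_pos (gap_pos hW.1 _) (gap_pos hV.1 _), ?_⟩
  refine eq_of_gap_eq hW.2 ?_ fun k => ?_
  · simp [← Finset.mul_sum, hV.2]
  · rw [gap_smul, ← h2 k, div_mul_cancel₀ _ (gap_pos hV.1 k).ne']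

/-- Above the threshold, the energy restricted to spheres has no critical point of
nonnegative energy. -/
lemma ne_smul_of_energy_nonneg {m χ : ℝ} (hm : 1 < m) {N : ℕ} (hN : 2 ≤ N)
    (hχ : threshold m N < χ) {V : Config N} (hV : V ∈ orderedConfigs N)
    (hE : 0 ≤ energy m χ V) (μ : ℝ) : velocity m χ V ≠ μ • V := by
  intro h
  have hχ0 : 0 < χ := (threshold_pos hm hN).trans hχ
  have hne : V ≠ 0 := by
    rintro rfl
    exact absurd (hV.1 ⟨0, by omega⟩ ⟨1, by omega⟩ (by simp [Fin.lt_def])) (by simp)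
  -- Pairing the equation with V gives μ|V|² = (m - 1) times the energy.
  have hμ : 0 ≤ μ := by
    have h1 := inner_velocity_self (χ := χ) hm hV.1
    rw [h, inner_smul_left, real_inner_self_eq_norm_sq] at h1
    simp only [conj_trivial] at h1
    have h2 : 0 < ‖V‖ ^ 2 := by positivity
    have h3 : 0 ≤ (m - 1) * energy m χ V := mul_nonneg (by linarith) hE
    rw [← h1] at h3
    exact nonneg_of_mul_nonneg_left h3 h2
  refine absurd ((isCertificate_of_velocity hV.1 fun k => ?_).le_threshold hm hχ0 hN) (not_le.2 hχ)
  rw [h]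
  simp only [PiLp.smul_apply, smul_eq_mul]
  rw [← Finset.mul_sum]
  refine mul_nonpos_of_nonneg_of_nonpos hμ ?_
  -- Chebyshev's sum inequality: the leftmost coordinates of an increasing centred configuration
  -- have nonpositive sum. With μ ≥ 0, V becomes a certificate and χ ≤ C_N.
  have hmv : Antivary (fun i : Fin N => if (i : ℕ) ≤ k then (1 : ℝ) else 0) V := by
    intro i j hij
    have : i < j := by
      by_contra hle
      rcases (not_lt.1 hle).lt_or_eq with h1 | h1
      · exact absurd (hV.1 _ _ h1) (not_lt.2 hij.le)
      · exact absurd hij (by rw [h1]; exact lt_irrefl _)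
    have h4 : (i : ℕ) < j := this
    simp only
    split_ifs <;> first | omega | norm_num
  have h5 := hmv.card_mul_sum_le_sum_mul_sum
  rw [hV.2, mul_zero] at h5
  simp only [ite_mul, one_mul, zero_mul, ← Finset.sum_filter, Fintype.card_fin] at h5
  have : (0 : ℝ) < N := by positivity
  nlinarith

/-! ### Regularity of the vector field away from collisions. -/

lemma gap_le_sub {N : ℕ} {X : Config N} (hX : ∀ i j : Fin N, i < j → X i < X j) {i j : Fin N}
    (hij : i < j) : gap X ⟨i, by have := Fin.lt_def.1 hij; omega⟩ ≤ X j - X i := by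
  have h := Fin.lt_def.1 hij
  have h1 := (strictMonoOn_toSeq hX).monotoneOn (Set.mem_Iio.2 (by omega : (i : ℕ) + 1 < N))
    (Set.mem_Iio.2 j.2) (by omega : (i : ℕ) + 1 ≤ j)
  rw [toSeq_of_lt X (by omega), toSeq_val] at h1
  exact sub_le_sub_right h1 _

lemma ordered_of_gap_pos {N : ℕ} {X : Config N} (h : ∀ k, 0 < gap X k) :
    ∀ i j : Fin N, i < j → X i < X j := by
  have h1 : StrictMonoOn (toSeq X) (Set.Iio N) := by
    refine strictMonoOn_of_lt_succ Set.ordConnected_Iio fun a _ ha ha' => ?_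
    have ha' : a + 1 < N := ha'
    have := h ⟨a, by omega⟩
    rw [← toSeq_sub] at this
    exact sub_pos.1 this
  intro i j hij
  have := h1 (Set.mem_Iio.2 i.2) (Set.mem_Iio.2 j.2) hij
  simpa using this

lemma le_abs_sub_of_le_gap {N : ℕ} {X : Config N} {c : ℝ} (hc : 0 < c) (h : ∀ k, c ≤ gap X k)
    {i j : Fin N} (hij : j ≠ i) : c ≤ |X j - X i| := by
  have hX := ordered_of_gap_pos fun k => hc.trans_le (h k)
  rcases lt_or_gt_of_ne hij with h1 | h1
  · rw [abs_sub_comm]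
    exact (h _).trans ((gap_le_sub hX h1).trans (le_abs_self _))
  · exact (h _).trans ((gap_le_sub hX h1).trans (le_abs_self _))

lemma exists_lipschitz_rpow_neg {m : ℝ} (hm : 0 < m) : ∃ K : ℝ, 0 ≤ K ∧
    ∀ u ∈ Set.Ici (1 / 2 : ℝ), ∀ u' ∈ Set.Ici (1 / 2 : ℝ),
      |u' ^ (-m) - u ^ (-m)| ≤ K * |u' - u| := by
  refine ⟨m * (1 / 2) ^ (-m - 1), by positivity, fun u hu u' hu' => ?_⟩
  refine (convex_Ici (1 / 2 : ℝ)).norm_image_sub_le_of_norm_hasDerivWithin_le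
    (f := fun x : ℝ => x ^ (-m)) (f' := fun x => -m * x ^ (-m - 1))
    (fun x hx => ?_) (fun x hx => ?_) hu hu'
  · have hx : (1 / 2 : ℝ) ≤ x := hx
    exact (Real.hasDerivAt_rpow_const (Or.inl (by linarith))).hasDerivWithinAt
  · have hx : (1 / 2 : ℝ) ≤ x := hx
    have hx0 : 0 < x := by linarith
    rw [norm_mul, norm_neg, Real.norm_of_nonneg hm.le, Real.norm_of_nonneg (by positivity)]
    exact mul_le_mul_of_nonneg_left
      (Real.rpow_le_rpow_of_nonpos (by norm_num) hx (by linarith)) hm.le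

lemma abs_coord_le {N : ℕ} (X : Config N) (i : Fin N) : |X i| ≤ ‖X‖ :=
  PiLp.norm_apply_le X i

lemma abs_coord_sub_le {N : ℕ} (X Y : Config N) (i j : Fin N) :
    |(X j - X i) - (Y j - Y i)| ≤ 2 * ‖X - Y‖ := by
  have h1 := abs_coord_le (X - Y) i
  have h2 := abs_coord_le (X - Y) j
  simp only [PiLp.sub_apply] at h1 h2
  calc |(X j - X i) - (Y j - Y i)| = |(X j - Y j) - (X i - Y i)| := by ring_nf
    _ ≤ |X j - Y j| + |X i - Y i| := abs_sub _ _
    _ ≤ _ := by linarith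

lemma norm_le_sum_abs {N : ℕ} (X : Config N) : ‖X‖ ≤ ∑ i, |X i| := by
  rw [EuclideanSpace.norm_eq, Real.sqrt_le_left (Finset.sum_nonneg fun i _ => abs_nonneg _)]
  simp only [Real.norm_eq_abs]
  exact Finset.sum_sq_le_sq_sum_of_nonneg fun i _ => abs_nonneg _

/-- The vector field is Lipschitz where the gaps are bounded from below. -/
lemma exists_lipschitz_velocity {m : ℝ} (hm : 0 < m) (χ : ℝ) (N : ℕ) : ∃ C : ℝ, 0 ≤ C ∧
    ∀ Z Z' : Config N, (∀ k, 1 / 2 ≤ gap Z k) → (∀ k, 1 / 2 ≤ gap Z' k) →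
      ‖velocity m χ Z' - velocity m χ Z‖ ≤ C * ‖Z' - Z‖ := by
  obtain ⟨K, hK, hlip⟩ := exists_lipschitz_rpow_neg hm
  refine ⟨N * ((2 + 2 * |χ| * N) * (2 * K)), by positivity, fun Z Z' hZ hZ' => ?_⟩
  have hhalf : (0 : ℝ) < 1 / 2 := by norm_num
  have hd : ∀ i j : Fin N, j ≠ i →
      |(|Z' j - Z' i| ^ (-m) - |Z j - Z i| ^ (-m))| ≤ 2 * K * ‖Z' - Z‖ := fun i j hij => by
    refine (hlip _ (le_abs_sub_of_le_gap hhalf hZ hij) _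
      (le_abs_sub_of_le_gap hhalf hZ' hij)).trans ?_
    rw [mul_comm 2 K, mul_assoc]
    exact mul_le_mul_of_nonneg_left ((abs_abs_sub_abs_le _ _).trans (abs_coord_sub_le _ _ _ _)) hK
  have hg : ∀ i j : Fin N, i < j →
      |((Z' j - Z' i) ^ (-m) - (Z j - Z i) ^ (-m))| ≤ 2 * K * ‖Z' - Z‖ := fun i j hij => by
    have := hd i j hij.ne'
    rwa [abs_of_pos (sub_pos.2 (ordered_of_gap_pos (fun k => hhalf.trans_le (hZ k)) i j hij)),
      abs_of_pos (sub_pos.2 (ordered_of_gap_pos (fun k => hhalf.trans_le (hZ' k)) i j hij))] at this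
  set D := 2 * K * ‖Z' - Z‖ with hD
  have hD0 : 0 ≤ D := by positivity
  have hi : ∀ i : Fin N, |(velocity m χ Z' - velocity m χ Z) i| ≤ (2 + 2 * |χ| * N) * D := by
    intro i
    have t1 : |(if h : (i : ℕ) + 1 < N then (Z' ⟨(i : ℕ) + 1, h⟩ - Z' i) ^ (-m) else 0) -
        (if h : (i : ℕ) + 1 < N then (Z ⟨(i : ℕ) + 1, h⟩ - Z i) ^ (-m) else 0)| ≤ D := by
      split_ifs with h
      · exact hg _ _ (by simp [Fin.lt_def])
      · simpa using hD0
    have t2 : |(if 0 < (i : ℕ) then (Z' i - Z' ⟨(i : ℕ) - 1, by omega⟩) ^ (-m) else 0) -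
        (if 0 < (i : ℕ) then (Z i - Z ⟨(i : ℕ) - 1, by omega⟩) ^ (-m) else 0)| ≤ D := by
      split_ifs with h
      · exact hg _ _ (by simp [Fin.lt_def]; omega)
      · simpa using hD0
    have t3 : |∑ j : Fin N with j ≠ i,
        ((Int.sign ((j : ℤ) - (i : ℤ)) : ℤ) : ℝ) * |Z' j - Z' i| ^ (-m) -
        ∑ j : Fin N with j ≠ i,
        ((Int.sign ((j : ℤ) - (i : ℤ)) : ℤ) : ℝ) * |Z j - Z i| ^ (-m)| ≤ N * D := by
      rw [← Finset.sum_sub_distrib]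
      refine (Finset.abs_sum_le_sum_abs _ _).trans ?_
      refine (Finset.sum_le_card_nsmul _ _ D fun j hj => ?_).trans ?_
      · have hj : j ≠ i := by simpa using hj
        rw [← mul_sub, abs_mul]
        have hs : |((Int.sign ((j : ℤ) - (i : ℤ)) : ℤ) : ℝ)| ≤ 1 := by
          rcases Int.sign_trichotomy ((j : ℤ) - (i : ℤ)) with h | h | h <;> rw [h] <;> simp
        exact (mul_le_of_le_one_left (abs_nonneg _) hs).trans (hd i j hj)
      · rw [nsmul_eq_mul]
        refine mul_le_mul_of_nonneg_right ?_ hD0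
        exact_mod_cast (Finset.card_le_univ _).trans (by simp)
    simp only [velocity, PiLp.sub_apply]
    rw [abs_le] at t1 t2 ⊢
    have t4 := mul_le_mul_of_nonneg_left t3 (abs_nonneg χ)
    rw [← abs_mul, abs_le, mul_sub] at t4
    constructor <;> nlinarith [t4.1, t4.2]
  calc ‖velocity m χ Z' - velocity m χ Z‖ ≤ ∑ i, |(velocity m χ Z' - velocity m χ Z) i| :=
        norm_le_sum_abs _
    _ ≤ ∑ _i : Fin N, (2 + 2 * |χ| * N) * D := Finset.sum_le_sum fun i _ => hi i
    _ = _ := by simp [hD]; ring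

lemma contDiffAt_velocity (m χ : ℝ) {N : ℕ} {X : Config N}
    (hX : ∀ i j : Fin N, i < j → X i < X j) :
    ContDiffAt ℝ 1 (velocity m χ : Config N → Config N) X := by
  have hp : ∀ i : Fin N, ContDiffAt ℝ 1 (fun Y : Config N => Y i) X := fun i =>
    (EuclideanSpace.proj (𝕜 := ℝ) i).contDiff.contDiffAt
  rw [contDiffAt_euclidean]
  intro i
  simp only [velocity]
  refine ((ContDiffAt.neg ?_).add ?_).add (contDiffAt_const.mul (ContDiffAt.sum fun j hj => ?_))
  · split_ifs with h
    · refine ((hp _).sub (hp _)).rpow_const_of_ne ?_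
      exact (sub_pos.2 (hX _ _ (by simp [Fin.lt_def]))).ne'
    · exact contDiffAt_const
  · split_ifs with h
    · refine ((hp _).sub (hp _)).rpow_const_of_ne ?_
      exact (sub_pos.2 (hX _ _ (by simp [Fin.lt_def]; omega))).ne'
    · exact contDiffAt_const
  · have hj : j ≠ i := by simpa using hj
    have hne : X j - X i ≠ 0 := by
      rcases lt_or_gt_of_ne hj with h | h
      · exact (sub_neg.2 (hX _ _ h)).ne
      · exact (sub_pos.2 (hX _ _ h)).ne'
    refine contDiffAt_const.mul (ContDiffAt.rpow_const_of_ne ?_ (abs_ne_zero.2 hne))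
    exact (contDiffAt_abs hne).comp X ((hp _).sub (hp _))

/-! ### Absence of blow-up, global flows and the unit sphere. -/

lemma continuous_gap {N : ℕ} (k : Fin (N - 1)) : Continuous fun X : Config N => gap X k :=
  (gapForm k).continuous

lemma exists_timesTo {T : EReal} (hT : 0 < T) : ∃ u : ℕ → ℝ, TimesTo T u := by
  induction T using EReal.rec with
  | bot => exact absurd hT (by simp)
  | coe τ =>
    have hτ : 0 < τ := by exact_mod_cast hT
    refine ⟨fun n => τ - τ * (1 / ((n : ℝ) + 1)), fun n => ⟨?_, ?_⟩, ?_⟩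
    · have : 1 / ((n : ℝ) + 1) ≤ 1 := by
        rw [div_le_one (by positivity)]; linarith [(Nat.cast_nonneg n : (0 : ℝ) ≤ n)]
      nlinarith
    · have : 0 < 1 / ((n : ℝ) + 1) := by positivity
      exact EReal.coe_lt_coe_iff.2 (by nlinarith)
    · refine EReal.tendsto_coe.2 ?_
      have := (tendsto_one_div_add_atTop_nhds_zero_nat (𝕜 := ℝ)).const_mul τ
      simpa using this.const_sub τ
  | top =>
    refine ⟨fun n => n, fun n => ⟨Nat.cast_nonneg n, EReal.coe_lt_top _⟩, ?_⟩
    rw [EReal.tendsto_coe_nhds_top_iff]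
    exact tendsto_natCast_atTop_atTop

lemma TimesTo.of_le {T : EReal} {u t : ℕ → ℝ} (hu : TimesTo T u) (h1 : ∀ n, u n ≤ t n)
    (h2 : ∀ n, (t n : EReal) < T) : TimesTo T t :=
  ⟨fun n => ⟨(hu.1 n).1.trans (h1 n), h2 n⟩,
    tendsto_of_tendsto_of_tendsto_of_le_of_le hu.2 tendsto_const_nhds
      (fun n => EReal.coe_le_coe_iff.2 (h1 n)) fun n => (h2 n).le⟩

lemma exists_const_subseq {ι : Type*} [Finite ι] (k : ℕ → ι) :
    ∃ (i : ι) (φ : ℕ → ℕ), StrictMono φ ∧ ∀ n, k (φ n) = i := by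
  obtain ⟨i, hi⟩ : ∃ i, ∃ᶠ n in atTop, k n = i := by
    by_contra! h
    obtain ⟨n, hn⟩ := (eventually_all.2 h).exists
    exact hn _ rfl
  exact ⟨i, extraction_of_frequently_atTop hi⟩

/-- Otherwise gaps below 1/(n+1) occur at times arbitrarily close to T; as there are finitely many
gaps, one index recurs along a subsequence. -/
lemma exists_gap_lower_bound {N : ℕ} {T : EReal} (hT : 0 < T) {X : ℝ → Config N}
    (hpos : ∀ t : ℝ, 0 ≤ t → (t : EReal) < T → ∀ k, 0 < gap (X t) k) (h : ¬ BlowsUp T X) :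
    ∃ c > 0, ∃ s : ℝ, 0 ≤ s ∧ (s : EReal) < T ∧
      ∀ t : ℝ, s ≤ t → (t : EReal) < T → ∀ k, c ≤ gap (X t) k := by
  obtain ⟨u, hu⟩ := exists_timesTo hT
  by_contra! hcon
  have h1 : ∀ n : ℕ, ∃ t : ℝ, u n ≤ t ∧ (t : EReal) < T ∧
      ∃ k, gap (X t) k < 1 / ((n : ℝ) + 1) := fun n =>
    hcon _ (by positivity) _ (hu.1 n).1 (hu.1 n).2
  choose t ht1 ht2 k hk using h1
  obtain ⟨k₀, φ, hφ, hφk⟩ := exists_const_subseq k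
  have hT' := TimesTo.of_le hu ht1 ht2
  refine h ⟨k₀, t ∘ φ, ⟨fun n => hT'.1 _, hT'.2.comp hφ.tendsto_atTop⟩, ?_⟩
  refine squeeze_zero (fun n => (hpos _ (hT'.1 _).1 (hT'.1 _).2 _).le) (fun n => ?_)
    ((tendsto_one_div_add_atTop_nhds_zero_nat (𝕜 := ℝ)).comp hφ.tendsto_atTop)
  have := hk (φ n)
  rw [hφk n] at this
  exact this.le

lemma antitoneOn_Ici_of_hasDerivWithinAt {a : ℝ} {f f' : ℝ → ℝ}
    (h : ∀ t, a ≤ t → HasDerivWithinAt f (f' t) (Set.Ici a) t) (h' : ∀ t, a ≤ t → f' t ≤ 0) :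
    AntitoneOn f (Set.Ici a) := by
  refine antitoneOn_of_hasDerivWithinAt_nonpos (convex_Ici a)
    (fun t ht => (h t ht).continuousWithinAt) (f' := f') (fun t ht => ?_) fun t ht => ?_
  · exact (h t (interior_subset ht)).mono interior_subset
  · exact h' t (interior_subset ht)

lemma ne_zero_of_mem {N : ℕ} (hN : 2 ≤ N) {X : Config N} (hX : X ∈ orderedConfigs N) : X ≠ 0 := by
  rintro rfl
  exact absurd (hX.1 ⟨0, by omega⟩ ⟨1, by omega⟩ (by simp [Fin.lt_def])) (by simp)

/-- A solution of the particle system which is defined for all times. -/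
structure IsGlobalFlow (m χ : ℝ) {N : ℕ} (X : ℝ → Config N) : Prop where
  mem : ∀ t : ℝ, 0 ≤ t → X t ∈ orderedConfigs N
  ode : ∀ t : ℝ, 0 ≤ t → HasDerivWithinAt X (velocity m χ (X t)) (Set.Ici 0) t

lemma IsSolution.isGlobalFlow {m χ : ℝ} {N : ℕ} {X₀ : Config N} {X : ℝ → Config N}
    (h : IsSolution m χ X₀ ⊤ X) : IsGlobalFlow m χ X where
  mem t ht := h.mem t ht (EReal.coe_lt_top t)
  ode t ht := by
    have := h.ode t ht (EReal.coe_lt_top t)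
    exact this.mono fun s hs => ⟨hs, EReal.coe_lt_top s⟩

lemma normalized_mem {N : ℕ} (hN : 2 ≤ N) {X : ℝ → Config N} {t : ℝ}
    (h : X t ∈ orderedConfigs N) : normalized X t ∈ orderedConfigs N :=
  smul_mem_orderedConfigs (inv_pos.2 (norm_pos_iff.2 (ne_zero_of_mem hN h))) h

lemma norm_normalized {N : ℕ} (hN : 2 ≤ N) {X : ℝ → Config N} {t : ℝ}
    (h : X t ∈ orderedConfigs N) : ‖normalized X t‖ = 1 := by
  rw [normalized, norm_smul, norm_inv, norm_norm,
    inv_mul_cancel₀ (norm_ne_zero_iff.2 (ne_zero_of_mem hN h))]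

lemma norm_smul_normalized {N : ℕ} (hN : 2 ≤ N) {X : ℝ → Config N} {t : ℝ}
    (h : X t ∈ orderedConfigs N) : ‖X t‖ • normalized X t = X t := by
  rw [normalized, smul_smul, mul_inv_cancel₀ (norm_ne_zero_iff.2 (ne_zero_of_mem hN h)), one_smul]

/-- The squared norm of the component of the velocity tangent to the unit sphere. -/
def tangentialSq (m χ : ℝ) {N : ℕ} (Y : Config N) : ℝ :=
  ‖velocity m χ Y‖ ^ 2 - ((m - 1) * energy m χ Y) ^ 2

lemma tangentialSq_eq {m χ : ℝ} (hm : 1 < m) {N : ℕ} {Y : Config N}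
    (hY : Y ∈ orderedConfigs N) (h1 : ‖Y‖ = 1) :
    tangentialSq m χ Y = ‖velocity m χ Y - ((m - 1) * energy m χ Y) • Y‖ ^ 2 := by
  rw [norm_sub_sq_real, inner_smul_right, inner_velocity_self hm hY.1, norm_smul, h1,
    Real.norm_eq_abs, mul_one, sq_abs, tangentialSq]
  ring

lemma tangentialSq_nonneg {m χ : ℝ} (hm : 1 < m) {N : ℕ} {Y : Config N}
    (hY : Y ∈ orderedConfigs N) (h1 : ‖Y‖ = 1) : 0 ≤ tangentialSq m χ Y := by
  rw [tangentialSq_eq hm hY h1]; positivity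

lemma tangentialSq_pos {m χ : ℝ} (hm : 1 < m) {N : ℕ} (hN : 2 ≤ N) (hχ : threshold m N < χ)
    {Y : Config N} (hY : Y ∈ orderedConfigs N) (h1 : ‖Y‖ = 1) (hE : 0 ≤ energy m χ Y) :
    0 < tangentialSq m χ Y := by
  rw [tangentialSq_eq hm hY h1]
  have := sub_ne_zero.2 (ne_smul_of_energy_nonneg hm hN hχ hY hE ((m - 1) * energy m χ Y))
  positivity

/-! ### Dissipation along a global solution, before and after renormalisation. -/

section Flow

variable {m χ : ℝ} {N : ℕ} {X : ℝ → Config N}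

lemma IsGlobalFlow.energy_deriv (h : IsGlobalFlow m χ X) (hm : 1 < m) {t : ℝ} (ht : 0 ≤ t) :
    HasDerivWithinAt (fun s => energy m χ (X s)) (-‖velocity m χ (X t)‖ ^ 2) (Set.Ici 0) t := by
  have h1 := (hasGradientAt_energy (χ := χ) hm (h.mem t ht).1).hasFDerivAt.comp_hasDerivWithinAt t
    (h.ode t ht)
  rw [InnerProductSpace.toDual_apply_apply, inner_neg_left, real_inner_self_eq_norm_sq] at h1
  exact h1

lemma IsGlobalFlow.normSq_deriv (h : IsGlobalFlow m χ X) (hm : 1 < m) {t : ℝ} (ht : 0 ≤ t) :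
    HasDerivWithinAt (fun s => ‖X s‖ ^ 2) (2 * ((m - 1) * energy m χ (X t))) (Set.Ici 0) t := by
  have h1 := (h.ode t ht).norm_sq
  rw [real_inner_comm, inner_velocity_self hm (h.mem t ht).1] at h1
  exact h1

lemma IsGlobalFlow.energy_antitone (h : IsGlobalFlow m χ X) (hm : 1 < m) :
    AntitoneOn (fun s => energy m χ (X s)) (Set.Ici 0) :=
  antitoneOn_Ici_of_hasDerivWithinAt (fun _ ht => h.energy_deriv hm ht)
    fun _ _ => neg_nonpos.2 (sq_nonneg _)

/-- Virial argument: the energy decreases, so once negative it makes |X|² decrease at least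
linearly, and |X|² would become negative in finite time. -/
lemma IsGlobalFlow.energy_nonneg (h : IsGlobalFlow m χ X) (hm : 1 < m) {t : ℝ} (ht : 0 ≤ t) :
    0 ≤ energy m χ (X t) := by
  by_contra! hneg
  set c := 2 * ((m - 1) * energy m χ (X t)) with hc
  have hc0 : c < 0 := by
    have : (m - 1) * energy m χ (X t) < 0 := mul_neg_of_pos_of_neg (by linarith) hneg
    linarith
  have hanti : AntitoneOn (fun s => ‖X s‖ ^ 2 - c * s) (Set.Ici t) := by
    refine antitoneOn_Ici_of_hasDerivWithinAt
      (f' := fun s => 2 * ((m - 1) * energy m χ (X s)) - c) (fun s hs => ?_) fun s hs => ?_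
    · have h1 := ((hasDerivAt_id s).const_mul c).hasDerivWithinAt (s := Set.Ici t)
      rw [mul_one] at h1
      exact ((h.normSq_deriv hm (ht.trans hs)).mono (Set.Ici_subset_Ici.2 ht)).sub h1
    · have h1 := h.energy_antitone hm (Set.mem_Ici.2 ht) (Set.mem_Ici.2 (ht.trans hs)) hs
      simp only at h1
      have := mul_le_mul_of_nonneg_left h1 (by linarith : 0 ≤ m - 1)
      linarith
  -- At this time the linear upper bound for |X|² equals -1.
  set s := t + (‖X t‖ ^ 2 + 1) / (-c) with hs
  have hts : t ≤ s := by
    have : 0 ≤ (‖X t‖ ^ 2 + 1) / (-c) := div_nonneg (by positivity) (by linarith)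
    linarith
  have h2 := hanti (Set.self_mem_Ici) (Set.mem_Ici.2 hts) hts
  simp only at h2
  have h3 : c * s = c * t - (‖X t‖ ^ 2 + 1) := by
    have := hc0.ne
    rw [hs]; field_simp; ring
  have h4 : 0 ≤ ‖X s‖ ^ 2 := by positivity
  linarith

lemma IsGlobalFlow.norm_deriv (h : IsGlobalFlow m χ X) (hm : 1 < m) (hN : 2 ≤ N) {t : ℝ}
    (ht : 0 ≤ t) :
    HasDerivWithinAt (fun s => ‖X s‖) ((m - 1) * energy m χ (X t) / ‖X t‖) (Set.Ici 0) t := by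
  have hr : ‖X t‖ ≠ 0 := norm_ne_zero_iff.2 (ne_zero_of_mem hN (h.mem t ht))
  have h1 := (h.normSq_deriv hm ht).sqrt (pow_ne_zero 2 hr)
  simp only [Real.sqrt_sq (norm_nonneg _)] at h1
  convert h1 using 1
  field_simp

lemma energy_normalized (h : IsGlobalFlow m χ X) (hN : 2 ≤ N) {t : ℝ} (ht : 0 ≤ t) :
    energy m χ (normalized X t) = ‖X t‖ ^ (m - 1) * energy m χ (X t) := by
  have hr : 0 < ‖X t‖ := norm_pos_iff.2 (ne_zero_of_mem hN (h.mem t ht))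
  rw [normalized, energy_smul (inv_pos.2 hr) (h.mem t ht).1, Real.inv_rpow hr.le,
    ← Real.rpow_neg hr.le, neg_sub]

lemma IsGlobalFlow.energy_normalized_nonneg (h : IsGlobalFlow m χ X) (hm : 1 < m) (hN : 2 ≤ N)
    {t : ℝ} (ht : 0 ≤ t) : 0 ≤ energy m χ (normalized X t) := by
  rw [energy_normalized h hN ht]
  exact mul_nonneg (Real.rpow_nonneg (norm_nonneg _) _) (h.energy_nonneg hm ht)

/-- Product rule for |X|^{m-1} times the energy: the growth of |X| offsets exactly the radial part
of the dissipation, and homogeneity leaves the factor |X|^{-(m+1)}. -/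
lemma IsGlobalFlow.energy_normalized_deriv (h : IsGlobalFlow m χ X) (hm : 1 < m) (hN : 2 ≤ N)
    {t : ℝ} (ht : 0 ≤ t) :
    HasDerivWithinAt (fun s => energy m χ (normalized X s))
      (-(‖X t‖ ^ (m + 1))⁻¹ * tangentialSq m χ (normalized X t)) (Set.Ici 0) t := by
  have hX := h.mem t ht
  have hr : 0 < ‖X t‖ := norm_pos_iff.2 (ne_zero_of_mem hN hX)
  have h1 := ((h.norm_deriv hm hN ht).rpow_const (p := m - 1) (Or.inl hr.ne')).mul
    (h.energy_deriv hm ht)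
  refine (h1.congr_of_mem (fun s hs => energy_normalized h hN hs) ht).congr_deriv ?_
  have hY := normalized_mem hN hX
  have hv : velocity m χ (X t) = ‖X t‖ ^ (-m) • velocity m χ (normalized X t) := by
    rw [← velocity_smul hr hY.1, norm_smul_normalized hN hX]
  have hE : energy m χ (X t) = ‖X t‖ ^ (1 - m) * energy m χ (normalized X t) := by
    rw [← energy_smul hr hY.1, norm_smul_normalized hN hX]
  rw [hv, hE, norm_smul, Real.norm_of_nonneg (Real.rpow_nonneg hr.le _), tangentialSq]
  set r := ‖X t‖
  have e1 : r ^ (m - 1) = r ^ m / r := by rw [Real.rpow_sub hr, Real.rpow_one]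
  have e2 : r ^ (m - 1 - 1) = r ^ m / r / r := by
    rw [Real.rpow_sub hr, Real.rpow_sub hr, Real.rpow_one]
  have e3 : r ^ (1 - m) = r / r ^ m := by rw [Real.rpow_sub hr, Real.rpow_one]
  have e4 : r ^ (-m) = (r ^ m)⁻¹ := Real.rpow_neg hr.le _
  have e5 : r ^ (m + 1) = r ^ m * r := by rw [Real.rpow_add hr, Real.rpow_one]
  have e6 : 0 < r ^ m := Real.rpow_pos_of_pos hr _
  rw [e1, e2, e3, e4, e5]
  field_simp
  ring

lemma IsGlobalFlow.energy_normalized_antitone (h : IsGlobalFlow m χ X) (hm : 1 < m)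
    (hN : 2 ≤ N) : AntitoneOn (fun s => energy m χ (normalized X s)) (Set.Ici 0) :=
  antitoneOn_Ici_of_hasDerivWithinAt (fun _ ht => h.energy_normalized_deriv hm hN ht)
    fun t ht => by
      rw [neg_mul]
      have := tangentialSq_nonneg (χ := χ) hm (normalized_mem hN (h.mem t ht))
        (norm_normalized hN (h.mem t ht))
      exact neg_nonpos.2 (by positivity)

lemma IsGlobalFlow.norm_rpow_deriv (h : IsGlobalFlow m χ X) (hm : 1 < m) (hN : 2 ≤ N) {t : ℝ}
    (ht : 0 ≤ t) :
    HasDerivWithinAt (fun s => ‖X s‖ ^ (m + 1))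
      ((m + 1) * (m - 1) * energy m χ (normalized X t)) (Set.Ici 0) t := by
  have hr : 0 < ‖X t‖ := norm_pos_iff.2 (ne_zero_of_mem hN (h.mem t ht))
  refine ((h.norm_deriv hm hN ht).rpow_const (p := m + 1) (Or.inl hr.ne')).congr_deriv ?_
  rw [energy_normalized h hN ht, show m + 1 - 1 = (m - 1) + 1 by ring, Real.rpow_add_one hr.ne']
  field_simp

/-- The derivative of |X|^{m+1} is a multiple of the renormalised energy, which never exceeds its
initial value. -/
lemma IsGlobalFlow.norm_rpow_le (h : IsGlobalFlow m χ X) (hm : 1 < m) (hN : 2 ≤ N) :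
    ∃ A > 0, ∃ B > 0, ∀ t, 0 ≤ t → ‖X t‖ ^ (m + 1) ≤ A + B * t := by
  set b := (m + 1) * (m - 1) * energy m χ (normalized X 0) with hb
  have hm2 : 0 ≤ (m + 1) * (m - 1) := mul_nonneg (by linarith) (by linarith)
  have hb0 : 0 ≤ b := mul_nonneg hm2 (h.energy_normalized_nonneg hm hN le_rfl)
  have hr : 0 < ‖X 0‖ := norm_pos_iff.2 (ne_zero_of_mem hN (h.mem 0 le_rfl))
  -- The slope b may be 0; b + 1 is positive and can be divided by later.
  refine ⟨‖X 0‖ ^ (m + 1), Real.rpow_pos_of_pos hr _, b + 1, by linarith, fun t ht => ?_⟩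
  have hanti : AntitoneOn (fun s => ‖X s‖ ^ (m + 1) - b * s) (Set.Ici 0) := by
    refine antitoneOn_Ici_of_hasDerivWithinAt
      (f' := fun s => (m + 1) * (m - 1) * energy m χ (normalized X s) - b)
      (fun s hs => ?_) fun s hs => ?_
    · have h1 := ((hasDerivAt_id s).const_mul b).hasDerivWithinAt (s := Set.Ici 0)
      rw [mul_one] at h1
      exact (h.norm_rpow_deriv hm hN hs).sub h1
    · have h1 := h.energy_normalized_antitone hm hN Set.self_mem_Ici (Set.mem_Ici.2 hs) hs
      exact sub_nonpos.2 (mul_le_mul_of_nonneg_left h1 hm2)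
  have h2 := hanti Set.self_mem_Ici (Set.mem_Ici.2 ht) ht
  simp only at h2
  linarith

/-- The admissible Y form a compact set on which `tangentialSq` is continuous and, by
`tangentialSq_pos`, positive. -/
lemma exists_tangentialSq_lower_bound (hm : 1 < m) (hN : 2 ≤ N) (hχ : threshold m N < χ) {c : ℝ}
    (hc : 0 < c) : ∃ δ > 0, ∀ Y ∈ orderedConfigs N, ‖Y‖ = 1 → (∀ k, c ≤ gap Y k) →
      0 ≤ energy m χ Y → δ ≤ tangentialSq m χ Y := by
  set K : Set (Config N) :=
    Metric.sphere 0 1 ∩ ({Y | ∑ i, Y i = 0} ∩ {Y | ∀ k, c ≤ gap Y k}) with hK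
  have hKord : ∀ Y ∈ K, Y ∈ orderedConfigs N := fun Y hY =>
    ⟨ordered_of_gap_pos fun k => hc.trans_le (hY.2.2 k), hY.2.1⟩
  have hKc : IsCompact K := by
    refine (isCompact_sphere 0 1).inter_right (IsClosed.inter ?_ ?_)
    · exact isClosed_eq (by fun_prop) continuous_const
    · rw [Set.ofPred_forall]
      exact isClosed_iInter fun k => isClosed_le continuous_const (continuous_gap k)
  have hEc : ContinuousOn (energy m χ : Config N → ℝ) K := fun Y hY =>
    (hasGradientAt_energy hm (hKord Y hY).1).hasFDerivAt.continuousAt.continuousWithinAt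
  have hVc : ContinuousOn (velocity m χ : Config N → Config N) K := fun Y hY =>
    (contDiffAt_velocity m χ (hKord Y hY).1).continuousAt.continuousWithinAt
  have hK' : IsCompact (K ∩ (energy m χ) ⁻¹' Set.Ici 0) :=
    hKc.of_isClosed_subset (hEc.preimage_isClosed_of_isClosed hKc.isClosed isClosed_Ici)
      Set.inter_subset_left
  have hTc : ContinuousOn (tangentialSq m χ : Config N → ℝ) (K ∩ (energy m χ) ⁻¹' Set.Ici 0) := by
    have h1 := hEc.mono (Set.inter_subset_left (t := (energy m χ) ⁻¹' Set.Ici 0))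
    have h2 := hVc.mono (Set.inter_subset_left (t := (energy m χ) ⁻¹' Set.Ici 0))
    exact (h2.norm.pow 2).sub ((continuousOn_const.mul h1).pow 2)
  rcases (K ∩ (energy m χ) ⁻¹' Set.Ici 0).eq_empty_or_nonempty with he | hne
  · refine ⟨1, one_pos, fun Y hY h1 h2 h3 => ?_⟩
    have : Y ∈ K ∩ (energy m χ) ⁻¹' Set.Ici 0 := ⟨⟨by simpa using h1, hY.2, h2⟩, h3⟩
    rw [he] at this
    exact absurd this (Set.notMem_empty Y)
  · obtain ⟨Z, hZ, hmin⟩ := hK'.exists_isMinOn hne hTc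
    refine ⟨tangentialSq m χ Z, tangentialSq_pos hm hN hχ (hKord Z hZ.1)
      (by simpa using hZ.1.1) hZ.2, fun Y hY h1 h2 h3 => hmin ⟨⟨by simpa using h1, hY.2, h2⟩, h3⟩⟩

/-- Above the threshold, the renormalised flow approaches the boundary. -/
lemma IsGlobalFlow.blowsUp_normalized (h : IsGlobalFlow m χ X) (hm : 1 < m) (hN : 2 ≤ N)
    (hχ : threshold m N < χ) : BlowsUp ⊤ (normalized X) := by
  by_contra hcon
  obtain ⟨c, hc, s, hs, -, hgap⟩ := exists_gap_lower_bound (T := ⊤) (by simp)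
    (fun t ht _ => gap_pos (normalized_mem hN (h.mem t ht)).1) hcon
  obtain ⟨δ, hδ, hδ'⟩ := exists_tangentialSq_lower_bound hm hN hχ hc
  obtain ⟨A, hA, B, hB, hAB⟩ := h.norm_rpow_le hm hN
  -- The renormalised energy decreases at least at the rate δ/(A + Bt), whose primitive is this
  -- diverging logarithm; that contradicts its nonnegativity.
  set H : ℝ → ℝ := fun t => energy m χ (normalized X t) + δ / B * Real.log (A + B * t) with hH
  have hpos : ∀ t, s ≤ t → 0 < A + B * t := fun t ht => by
    have : 0 ≤ B * t := mul_nonneg hB.le (hs.trans ht)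
    linarith
  have hanti : AntitoneOn H (Set.Ici s) := by
    refine antitoneOn_Ici_of_hasDerivWithinAt
      (f' := fun t => -(‖X t‖ ^ (m + 1))⁻¹ * tangentialSq m χ (normalized X t) +
        δ / B * (B / (A + B * t))) (fun t ht => ?_) fun t ht => ?_
    · have h1 := (((hasDerivAt_id t).const_mul B).const_add A).log (hpos t ht).ne'
      rw [mul_one] at h1
      exact ((h.energy_normalized_deriv hm hN (hs.trans ht)).mono (Set.Ici_subset_Ici.2 hs)).add
        (h1.const_mul (δ / B)).hasDerivWithinAt
    · have ht0 := hs.trans ht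
      have hr : 0 < ‖X t‖ ^ (m + 1) :=
        Real.rpow_pos_of_pos (norm_pos_iff.2 (ne_zero_of_mem hN (h.mem t ht0))) _
      have h1 := hδ' _ (normalized_mem hN (h.mem t ht0)) (norm_normalized hN (h.mem t ht0))
        (hgap t ht (EReal.coe_lt_top t)) (h.energy_normalized_nonneg hm hN ht0)
      have h2 : (A + B * t)⁻¹ ≤ (‖X t‖ ^ (m + 1))⁻¹ := inv_anti₀ hr (hAB t ht0)
      have h3 : δ / B * (B / (A + B * t)) = (A + B * t)⁻¹ * δ := by
        have := (hpos t ht).ne'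
        field_simp
      have h4 : (A + B * t)⁻¹ * δ ≤
          (‖X t‖ ^ (m + 1))⁻¹ * tangentialSq m χ (normalized X t) :=
        mul_le_mul h2 h1 hδ.le (inv_pos.2 hr).le
      rw [h3]
      linarith
  have hlim : Tendsto (fun t => δ / B * Real.log (A + B * t)) atTop atTop :=
    (Real.tendsto_log_atTop.comp
      (tendsto_atTop_add_const_left _ A (tendsto_id.const_mul_atTop hB))).const_mul_atTop
      (div_pos hδ hB)
  obtain ⟨t, h1, h2⟩ := ((hlim.eventually_gt_atTop (H s)).and (eventually_ge_atTop s)).exists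
  have h3 := hanti Set.self_mem_Ici (Set.mem_Ici.2 h2) h2
  have h4 := h.energy_normalized_nonneg hm hN (hs.trans h2)
  simp only [hH] at h1 h3
  linarith

/-! ### Dissipation at the scale of the smallest gap. -/

/-- If the velocity is not small compared with the size of the gaps, the energy is large. -/
lemma IsGlobalFlow.exists_le_energy (h : IsGlobalFlow m χ X) (hm : 1 < m) {θ : ℝ} (hθ : 0 < θ) :
    ∃ κ > 0, ∀ t, 0 ≤ t → ∀ η > 0, (∀ k, η ≤ gap (X t) k) →
      θ ≤ η ^ m * ‖velocity m χ (X t)‖ → κ * η ^ (1 - m) ≤ energy m χ (X t) := by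
  obtain ⟨C, hC, hlip⟩ := exists_lipschitz_velocity (by linarith : 0 < m) χ N
  -- In units of η, a displacement of at most ρ keeps all gaps above 1/2 (hence 1/4) and changes the
  -- velocity by at most Cρ ≤ θ/2.
  set ρ := min (1 / 4) (θ / (2 * C + 1)) with hρ
  have hρ0 : 0 < ρ := by positivity
  have hρ1 : ρ ≤ 1 / 4 := min_le_left _ _
  have hρ2 : C * ρ ≤ θ / 2 := by
    have h1 : ρ ≤ θ / (2 * C + 1) := min_le_right _ _
    rw [le_div_iff₀ (by positivity)] at h1
    nlinarith
  refine ⟨θ * ρ / 8, by positivity, fun t ht η hη hgap hθη => ?_⟩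
  set w := ‖velocity m χ (X t)‖ with hw
  have hηm : 0 < η ^ m := Real.rpow_pos_of_pos hη _
  have hw0 : 0 < w := by
    by_contra! hle
    have := mul_nonpos_of_nonneg_of_nonpos hηm.le hle
    linarith
  have hw1 : η ^ (-m) * (θ / 2) ≤ w / 2 := by
    rw [Real.rpow_neg hη.le, inv_mul_le_iff₀ hηm]
    linarith
  have hscale : ∀ x, 0 ≤ x → velocity m χ (X x) = η ^ (-m) • velocity m χ (η⁻¹ • X x) :=
    fun x hx => by
      rw [← velocity_smul hη (smul_mem_orderedConfigs (inv_pos.2 hη) (h.mem x hx)).1, smul_smul,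
        mul_inv_cancel₀ hη.ne', one_smul]
  have hclose : ∀ x, 0 ≤ x → ‖X x - X t‖ ≤ η * ρ →
      ‖velocity m χ (X x) - velocity m χ (X t)‖ ≤ w / 2 := by
    intro x hx hxt
    have hnorm : ‖η⁻¹ • X x - η⁻¹ • X t‖ ≤ ρ := by
      rw [← smul_sub, norm_smul, norm_inv, Real.norm_of_nonneg hη.le, inv_mul_le_iff₀ hη]
      exact hxt
    have g1 : ∀ k, 1 ≤ gap (η⁻¹ • X t) k := fun k => by
      rw [gap_smul, ← div_eq_inv_mul, one_le_div hη]
      exact hgap k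
    have g2 : ∀ k, 1 / 2 ≤ gap (η⁻¹ • X x) k := fun k => by
      have h1 := abs_coord_sub_le (η⁻¹ • X x) (η⁻¹ • X t) ⟨(k : ℕ), by omega⟩
        ⟨(k : ℕ) + 1, by omega⟩
      have h2 := (abs_le.1 (h1.trans (mul_le_mul_of_nonneg_left hnorm two_pos.le))).1
      have h3 := g1 k
      rw [gap] at h3 ⊢
      linarith
    rw [hscale x hx, hscale t ht, ← smul_sub, norm_smul,
      Real.norm_of_nonneg (Real.rpow_nonneg hη.le _)]
    refine le_trans (mul_le_mul_of_nonneg_left ?_ (Real.rpow_nonneg hη.le _)) hw1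
    refine (hlip _ _ (fun k => by linarith [g1 k]) g2).trans ?_
    exact (mul_le_mul_of_nonneg_left hnorm hC).trans hρ2
  -- The time needed to travel ηρ at speed 2w. During it the speed stays at least w/2, so the energy
  -- lost is at least (w/2)²τ = wηρ/8.
  set τ := η * ρ / (2 * w) with hτ
  have hτ0 : 0 < τ := by positivity
  have hτw : 2 * w * τ = η * ρ := by rw [hτ]; field_simp
  -- Barrier argument: whenever the displacement meets the barrier it is still at most ηρ, so the
  -- speed is at most 3w/2, below the slope 2w.
  have hmove : ∀ x ∈ Set.Icc t (t + τ), ‖X x - X t‖ ≤ 2 * w * (x - t) := by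
    refine image_norm_le_of_norm_deriv_right_lt_deriv_boundary (f := fun x => X x - X t)
      (f' := fun x => velocity m χ (X x)) (B := fun x => 2 * w * (x - t))
      (B' := fun _ => 2 * w) ?_ ?_ ?_ ?_ ?_
    · exact fun x hx => (((h.ode x (ht.trans hx.1)).continuousWithinAt).mono
        (fun y hy => ht.trans hy.1)).sub continuousWithinAt_const
    · exact fun x hx => ((h.ode x (ht.trans hx.1)).mono
        (Set.Ici_subset_Ici.2 (ht.trans hx.1))).sub_const _
    · simp
    · intro x
      simpa using ((hasDerivAt_id x).sub_const t).const_mul (2 * w)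
    · intro x hx hxB
      have h1 : ‖X x - X t‖ ≤ η * ρ := by
        rw [hxB, ← hτw]
        exact mul_le_mul_of_nonneg_left (by linarith [hx.2]) (by positivity)
      have h2 := hclose x (ht.trans hx.1) h1
      have h3 := norm_sub_norm_le (velocity m χ (X x)) (velocity m χ (X t))
      linarith
  have hslow : ∀ x ∈ Set.Icc t (t + τ), w / 2 ≤ ‖velocity m χ (X x)‖ := by
    intro x hx
    have h1 : ‖X x - X t‖ ≤ η * ρ := by
      refine (hmove x hx).trans ?_
      rw [← hτw]
      exact mul_le_mul_of_nonneg_left (by linarith [hx.2]) (by positivity)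
    have h2 := hclose x (ht.trans hx.1) h1
    have h3 := norm_sub_norm_le (velocity m χ (X t)) (velocity m χ (X x))
    rw [norm_sub_rev] at h3
    linarith
  have hanti : AntitoneOn (fun x => energy m χ (X x) + (w / 2) ^ 2 * x) (Set.Icc t (t + τ)) := by
    refine antitoneOn_of_hasDerivWithinAt_nonpos (convex_Icc _ _)
      (f' := fun x => -‖velocity m χ (X x)‖ ^ 2 + (w / 2) ^ 2) ?_ ?_ ?_
    · exact fun x hx => (((h.energy_deriv hm (ht.trans hx.1)).continuousWithinAt).mono
        (fun y hy => ht.trans hy.1)).add (by fun_prop)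
    · intro x hx
      have hx' := interior_subset hx
      have h1 := ((hasDerivAt_id x).const_mul ((w / 2) ^ 2)).hasDerivWithinAt
        (s := interior (Set.Icc t (t + τ)))
      rw [mul_one] at h1
      exact ((h.energy_deriv hm (ht.trans hx'.1)).mono
        (fun y hy => ht.trans (interior_subset hy).1)).add h1
    · intro x hx
      have h1 := hslow x (interior_subset hx)
      have h2 := pow_le_pow_left₀ (by positivity) h1 2
      linarith
  have h1 := hanti (Set.left_mem_Icc.2 (by linarith)) (Set.right_mem_Icc.2 (by linarith))
    (by linarith : t ≤ t + τ)
  simp only at h1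
  have h2 := h.energy_nonneg hm (by linarith : 0 ≤ t + τ)
  have h3 : (w / 2) ^ 2 * τ = w * (η * ρ) / 8 := by rw [← hτw]; ring
  have h4 : θ * ρ / 8 * η ^ (1 - m) ≤ w * (η * ρ) / 8 := by
    have : η ^ (1 - m) = η * η ^ (-m) := by
      rw [sub_eq_add_neg, Real.rpow_add hη, Real.rpow_one]
    rw [this]
    have h5 : 0 ≤ η * ρ := by positivity
    nlinarith [mul_le_mul_of_nonneg_right hw1 h5]
  linarith

/-- The velocity is small compared with the size of the gaps, when some gap is small. -/
lemma IsGlobalFlow.exists_velocity_lt (h : IsGlobalFlow m χ X) (hm : 1 < m) (hN : 2 ≤ N) {θ : ℝ}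
    (hθ : 0 < θ) : ∃ η₀ > 0, ∀ t, 0 ≤ t → ∀ η > 0, η < η₀ →
      (∀ k, η ≤ gap (normalized X t) k) → η ^ m * ‖velocity m χ (normalized X t)‖ < θ := by
  obtain ⟨κ, hκ, hκ'⟩ := h.exists_le_energy hm hθ
  -- For small η the required energy would exceed the initial renormalised energy, an upper bound at
  -- all times.
  have hlim : Tendsto (fun η : ℝ => κ * η ^ (1 - m)) (𝓝[>] 0) atTop :=
    (tendsto_rpow_neg_nhdsGT_zero (by linarith)).const_mul_atTop hκ
  have hev := hlim.eventually_gt_atTop (energy m χ (normalized X 0))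
  obtain ⟨η₀, hη₀, hη₀'⟩ := mem_nhdsGT_iff_exists_Ioo_subset.1 hev
  refine ⟨η₀, hη₀, fun t ht η hη hlt hgap => ?_⟩
  by_contra! hle
  have hX := h.mem t ht
  have hr : 0 < ‖X t‖ := norm_pos_iff.2 (ne_zero_of_mem hN hX)
  have hXt := norm_smul_normalized hN hX
  have hY := normalized_mem hN hX
  have hv : velocity m χ (X t) = ‖X t‖ ^ (-m) • velocity m χ (normalized X t) := by
    rw [← velocity_smul hr hY.1, hXt]
  have h1 := hκ' t ht (‖X t‖ * η) (by positivity) (fun k => by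
    have := mul_le_mul_of_nonneg_left (hgap k) hr.le
    rwa [← gap_smul, hXt] at this) (by
    rw [hv, norm_smul, Real.norm_of_nonneg (Real.rpow_nonneg hr.le _),
      Real.mul_rpow hr.le hη.le, Real.rpow_neg hr.le]
    have : ‖X t‖ ^ m ≠ 0 := (Real.rpow_pos_of_pos hr _).ne'
    field_simp
    exact hle)
  have hE : energy m χ (X t) = ‖X t‖ ^ (1 - m) * energy m χ (normalized X t) := by
    rw [← energy_smul hr hY.1, hXt]
  rw [hE, Real.mul_rpow hr.le hη.le, mul_left_comm] at h1
  have h2 := le_of_mul_le_mul_left h1 (Real.rpow_pos_of_pos hr _)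
  have h3 := h.energy_normalized_antitone hm hN Set.self_mem_Ici (Set.mem_Ici.2 ht) ht
  have h4 : energy m χ (normalized X 0) < κ * η ^ (1 - m) := hη₀' ⟨hη, hlt⟩
  simp only at h3
  linarith

end Flow

/-! ### Continuation of solutions. -/

lemma exists_velocity_bound {m : ℝ} (hm : 0 < m) (χ : ℝ) (N : ℕ) {c : ℝ} (hc : 0 < c) :
    ∃ M : ℝ, ∀ Z : Config N, (∀ k, c ≤ gap Z k) → ‖velocity m χ Z‖ ≤ M := by
  refine ⟨N * ((2 + 2 * |χ| * N) * c ^ (-m)), fun Z hZ => ?_⟩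
  have hZo := ordered_of_gap_pos fun k => hc.trans_le (hZ k)
  set D := c ^ (-m) with hD
  have hD0 : 0 ≤ D := by positivity
  have hd : ∀ i j : Fin N, j ≠ i → |(|Z j - Z i| ^ (-m))| ≤ D := fun i j hij => by
    rw [abs_of_nonneg (by positivity)]
    exact Real.rpow_le_rpow_of_nonpos hc (le_abs_sub_of_le_gap hc hZ hij) (by linarith)
  have hg : ∀ i j : Fin N, i < j → |(Z j - Z i) ^ (-m)| ≤ D := fun i j hij => by
    have := hd i j hij.ne'
    rwa [abs_of_pos (sub_pos.2 (hZo i j hij))] at this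
  have hi : ∀ i : Fin N, |velocity m χ Z i| ≤ (2 + 2 * |χ| * N) * D := by
    intro i
    have t1 : |(if h : (i : ℕ) + 1 < N then (Z ⟨(i : ℕ) + 1, h⟩ - Z i) ^ (-m) else 0)| ≤ D := by
      split_ifs with h
      · exact hg _ _ (by simp [Fin.lt_def])
      · simpa using hD0
    have t2 : |(if 0 < (i : ℕ) then (Z i - Z ⟨(i : ℕ) - 1, by omega⟩) ^ (-m) else 0)| ≤ D := by
      split_ifs with h
      · exact hg _ _ (by simp [Fin.lt_def]; omega)
      · simpa using hD0
    have t3 : |∑ j : Fin N with j ≠ i,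
        ((Int.sign ((j : ℤ) - (i : ℤ)) : ℤ) : ℝ) * |Z j - Z i| ^ (-m)| ≤ N * D := by
      refine (Finset.abs_sum_le_sum_abs _ _).trans ?_
      refine (Finset.sum_le_card_nsmul _ _ D fun j hj => ?_).trans ?_
      · have hj : j ≠ i := by simpa using hj
        rw [abs_mul]
        have hs : |((Int.sign ((j : ℤ) - (i : ℤ)) : ℤ) : ℝ)| ≤ 1 := by
          rcases Int.sign_trichotomy ((j : ℤ) - (i : ℤ)) with h | h | h <;> rw [h] <;> simp
        exact (mul_le_of_le_one_left (abs_nonneg _) hs).trans (hd i j hj)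
      · rw [nsmul_eq_mul]
        refine mul_le_mul_of_nonneg_right ?_ hD0
        exact_mod_cast (Finset.card_le_univ _).trans (by simp)
    simp only [velocity]
    rw [abs_le] at t1 t2 ⊢
    have t4 := mul_le_mul_of_nonneg_left t3 (abs_nonneg χ)
    rw [← abs_mul, abs_le] at t4
    constructor <;> nlinarith [t4.1, t4.2]
  calc ‖velocity m χ Z‖ ≤ ∑ i, |velocity m χ Z i| := norm_le_sum_abs _
    _ ≤ ∑ _i : Fin N, (2 + 2 * |χ| * N) * D := Finset.sum_le_sum fun i _ => hi i
    _ = _ := by simp [hD]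

lemma isOpen_setOf_ordered (N : ℕ) :
    IsOpen {X : Config N | ∀ i j : Fin N, i < j → X i < X j} := by
  simp only [Set.ofPred_forall]
  exact isOpen_iInter_of_finite fun i => isOpen_iInter_of_finite fun j =>
    isOpen_iInter_of_finite fun _ => isOpen_lt (by fun_prop) (by fun_prop)

/-- Near an ordered configuration, the existence time is bounded from below. -/
lemma exists_uniform_local_solution (m χ : ℝ) {N : ℕ} {Z : Config N}
    (hZ : ∀ i j : Fin N, i < j → Z i < Z j) :
    ∃ ε > 0, ∀ x ∈ orderedConfigs N, dist x Z < ε → ∀ t₀ : ℝ, ∃ β : ℝ → Config N, β t₀ = x ∧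
      ∀ t, t₀ ≤ t → t < t₀ + ε → β t ∈ orderedConfigs N ∧ HasDerivAt β (velocity m χ (β t)) t := by
  obtain ⟨ε₁, hε₁, a, r, L, K, hr, hpl⟩ :=
    IsPicardLindelof.of_contDiffAt_one (contDiffAt_velocity m χ hZ)
  obtain ⟨α, hα, hαc⟩ := (hpl 0).exists_forall_mem_closedBall_eq_hasDerivWithinAt_continuousOn
  simp only [zero_sub, zero_add] at hα hαc
  have hS : Metric.closedBall Z r ×ˢ Set.Icc (-ε₁) ε₁ ∈ 𝓝 (Z, (0 : ℝ)) :=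
    prod_mem_nhds (Metric.closedBall_mem_nhds _ hr) (Icc_mem_nhds (by linarith) hε₁)
  have h0 : α (Z, 0) = Z := (hα Z (Metric.mem_closedBall_self r.2)).1
  -- The local flow is jointly continuous and the strict ordering is open, which gives one ε for all
  -- starting points near Z.
  have hU : ∀ᶠ p in 𝓝 (Z, (0 : ℝ)), ∀ i j : Fin N, i < j → α p i < α p j := by
    have h1 := (hαc.continuousAt hS).preimage_mem_nhds
      ((isOpen_setOf_ordered N).mem_nhds (by rw [h0]; exact hZ))
    exact h1
  obtain ⟨ε, hε, hball⟩ := Metric.eventually_nhds_iff.1 (hU.and (eventually_mem_set.2 hS))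
  have hmin : 0 < min ε ε₁ := lt_min hε hε₁
  refine ⟨min ε ε₁, hmin, fun x hx hxZ t₀ => ⟨fun t => α (x, t - t₀), ?_, ?_⟩⟩
  · have h1 := (hball (y := (x, 0)) (by
      simpa [Prod.dist_eq, hε] using hxZ.trans_le (min_le_left _ _))).2
    simpa using (hα x h1.1).1
  have hb : ∀ t, t₀ ≤ t → t < t₀ + min ε ε₁ →
      (∀ i j : Fin N, i < j → α (x, t - t₀) i < α (x, t - t₀) j) ∧
      HasDerivAt (fun t => α (x, t - t₀)) (velocity m χ (α (x, t - t₀))) t := by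
    intro t ht1 ht2
    have hlt : t - t₀ < min ε ε₁ := by linarith
    have h1 := hball (y := (x, t - t₀)) (by
      rw [Prod.dist_eq]
      refine max_lt (hxZ.trans_le (min_le_left _ _)) ?_
      rw [Real.dist_eq, sub_zero, abs_of_nonneg (by linarith)]
      exact hlt.trans_le (min_le_left _ _))
    refine ⟨h1.1, ?_⟩
    have h2 := ((hα x h1.2.1).2 _ h1.2.2).hasDerivAt
      (Icc_mem_nhds (by linarith) (hlt.trans_le (min_le_right _ _)))
    exact h2.comp_sub_const t t₀
  intro t ht1 ht2
  refine ⟨⟨(hb t ht1 ht2).1, ?_⟩, (hb t ht1 ht2).2⟩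
  -- The forces sum to zero, so the centre of mass remains at 0.
  have hsum : ∀ s, t₀ ≤ s → s < t₀ + min ε ε₁ →
      HasDerivAt (fun s => ∑ i, α (x, s - t₀) i) 0 s := fun s h1 h2 => by
    have h3 := HasDerivAt.fun_sum (u := Finset.univ) (A := fun (i : Fin N) s => α (x, s - t₀) i)
      (A' := fun i => velocity m χ (α (x, s - t₀)) i) (x := s) fun i _ =>
        ((EuclideanSpace.proj (𝕜 := ℝ) i).hasFDerivAt.comp_hasDerivAt s (hb s h1 h2).2)
    rwa [sum_velocity] at h3
  have h1 := constant_of_has_deriv_right_zero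
    (fun s hs => (hsum s hs.1 (hs.2.trans_lt ht2)).continuousAt.continuousWithinAt)
    (fun s hs => (hsum s hs.1 (hs.2.trans ht2)).hasDerivWithinAt) t (Set.right_mem_Icc.2 ht1)
  rw [h1]
  have h2 := (hball (y := (x, 0)) (by
      simpa [Prod.dist_eq, hε] using hxZ.trans_le (min_le_left _ _))).2
  simp only [sub_self, (hα x h2.1).1]
  exact hx.2

/-- A solution can be continued by another solution. -/
lemma IsSolution.glue {m χ : ℝ} {N : ℕ} {X₀ : Config N} {T : EReal} {X : ℝ → Config N}
    (h : IsSolution m χ X₀ T X) {s ε : ℝ} (hs : 0 ≤ s) (hsT : (s : EReal) < T) (hε : 0 < ε)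
    {β : ℝ → Config N} (hβ : β s = X s)
    (hβ' : ∀ t, s ≤ t → t < s + ε →
      β t ∈ orderedConfigs N ∧ HasDerivAt β (velocity m χ (β t)) t) :
    IsSolution m χ X₀ ((s + ε : ℝ) : EReal) (fun t => if t ≤ s then X t else β t) := by
  have hltT : ∀ t : ℝ, t ≤ s → (t : EReal) < T := fun t ht =>
    (EReal.coe_le_coe_iff.2 ht).trans_lt hsT
  have hbeta : ∀ t : ℝ, s ≤ t → (if t ≤ s then X t else β t) = β t := fun t ht => by
    split_ifs with h1
    · rw [le_antisymm h1 ht, hβ]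
    · rfl
  have hset : {t : ℝ | 0 ≤ t ∧ (t : EReal) < ((s + ε : ℝ) : EReal)} = Set.Ico 0 (s + ε) := by
    ext t; exact and_congr_right fun _ => EReal.coe_lt_coe_iff
  refine ⟨by exact_mod_cast (by linarith : 0 < s + ε), by simp [hs, h.init], ?_, ?_⟩
  · intro t ht htT
    have htT := EReal.coe_lt_coe_iff.1 htT
    split_ifs with h1
    · exact h.mem t ht (hltT t h1)
    · exact (hβ' t (not_le.1 h1).le htT).1
  · intro t ht htT
    have htT := EReal.coe_lt_coe_iff.1 htT
    rw [hset]
    have hA : t ≤ s → HasDerivWithinAt (fun t => if t ≤ s then X t else β t)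
        (velocity m χ (X t)) (Set.Icc 0 s) t := fun h1 =>
      ((h.ode t ht (hltT t h1)).mono fun y hy => ⟨hy.1, hltT y hy.2⟩).congr
        (fun y hy => if_pos hy.2) (if_pos h1)
    have hB : s ≤ t → HasDerivWithinAt (fun t => if t ≤ s then X t else β t)
        (velocity m χ (β t)) (Set.Ici s) t := fun h1 =>
      (hβ' t h1 htT).2.hasDerivWithinAt.congr (fun y hy => hbeta y hy) (hbeta t h1)
    rcases lt_trichotomy t s with h1 | h1 | h1
    · simp only [if_pos h1.le]
      refine (hA h1.le).mono_of_mem_nhdsWithin ?_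
      filter_upwards [self_mem_nhdsWithin, mem_nhdsWithin_of_mem_nhds (Iio_mem_nhds h1)] with y h2 h3
      exact ⟨h2.1, h3.le⟩
    · subst h1
      simp only [le_refl, if_true]
      have hB' := hB le_rfl
      rw [hβ] at hB'
      refine ((hA le_rfl).union hB').mono fun y hy => ?_
      rcases le_total y t with h2 | h2
      · exact Or.inl ⟨hy.1, h2⟩
      · exact Or.inr h2
    · simp only [if_neg (not_le.2 h1)]
      exact ((hB h1.le).hasDerivAt (Ici_mem_nhds h1)).hasDerivWithinAt

/-- A maximal solution which is not global blows up. -/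
lemma IsMaximalSolution.blowsUp {m χ : ℝ} (hm : 0 < m) {N : ℕ} {X₀ : Config N} {T : EReal}
    {X : ℝ → Config N} (h : IsMaximalSolution m χ X₀ T X) (hT : T < ⊤) : BlowsUp T X := by
  by_contra hcon
  have hsol := h.sol
  obtain ⟨c, hc, s, hs, hsT, hgap⟩ := exists_gap_lower_bound hsol.pos
    (fun t ht htT => gap_pos (hsol.mem t ht htT).1) hcon
  obtain ⟨M, hM⟩ := exists_velocity_bound hm χ N hc
  induction T using EReal.rec with
  | bot => exact absurd hsol.pos (by simp)
  | top => exact absurd hT (lt_irrefl _)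
  | coe τ =>
  have hsτ : s < τ := EReal.coe_lt_coe_iff.1 hsT
  have hM0 : 0 ≤ M := (norm_nonneg _).trans (hM _ (hgap s le_rfl hsT))
  have hbound : ∀ t, s ≤ t → t < τ → ‖X t‖ ≤ ‖X s‖ + M * (τ - s) := by
    intro t h1 h2
    have h3 := norm_image_sub_le_of_norm_deriv_le_segment' (f := X)
      (f' := fun x => velocity m χ (X x)) (a := s) (b := t) (C := M)
      (fun x hx => (hsol.ode x (hs.trans hx.1)
        (EReal.coe_lt_coe_iff.2 (hx.2.trans_lt h2))).mono fun y hy =>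
          ⟨hs.trans hy.1, EReal.coe_lt_coe_iff.2 (hy.2.trans_lt h2)⟩)
      (fun x hx => hM _ (hgap x hx.1 (EReal.coe_lt_coe_iff.2 (hx.2.trans h2))))
      t (Set.right_mem_Icc.2 h1)
    have h4 := norm_sub_norm_le (X t) (X s)
    have h5 : M * (t - s) ≤ M * (τ - s) := mul_le_mul_of_nonneg_left (by linarith) hM0
    linarith
  obtain ⟨u, hu⟩ := exists_timesTo hsol.pos
  have hmaxT : ∀ n, max s (u n) < τ := fun n =>
    max_lt hsτ (EReal.coe_lt_coe_iff.1 (hu.1 n).2)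
  have hut := hu.of_le (t := fun n => max s (u n)) (fun n => le_max_right _ _)
    fun n => EReal.coe_lt_coe_iff.2 (hmaxT n)
  have hK : IsCompact (Metric.closedBall (0 : Config N) (‖X s‖ + M * (τ - s)) ∩
      {Y | ∀ k, c ≤ gap Y k}) := by
    refine (isCompact_closedBall _ _).inter_right ?_
    rw [Set.ofPred_forall]
    exact isClosed_iInter fun k => isClosed_le continuous_const (continuous_gap k)
  -- Near this cluster point the existence time is at least ε; restarting less than ε before τ
  -- continues the solution past τ.
  obtain ⟨Z, hZ, φ, hφ, hlim⟩ := hK.tendsto_subseq (x := fun n => X (max s (u n))) fun n =>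
    ⟨mem_closedBall_zero_iff.2 (hbound _ (le_max_left _ _) (hmaxT n)),
      hgap _ (le_max_left _ _) (EReal.coe_lt_coe_iff.2 (hmaxT n))⟩
  obtain ⟨ε, hε, hloc⟩ := exists_uniform_local_solution m χ
    (ordered_of_gap_pos fun k => hc.trans_le (hZ.2 k))
  have h1 : ∀ᶠ n in atTop, dist (X (max s (u (φ n)))) Z < ε :=
    hlim.eventually (Metric.ball_mem_nhds Z hε)
  have h2 : ∀ᶠ n in atTop, τ - ε < max s (u (φ n)) :=
    ((EReal.tendsto_coe.1 hut.2).comp hφ.tendsto_atTop).eventually_const_lt (by linarith)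
  obtain ⟨n, h3, h4⟩ := (h1.and h2).exists
  have h5 := hsol.mem _ (hs.trans (le_max_left s (u (φ n))))
    (EReal.coe_lt_coe_iff.2 (hmaxT (φ n)))
  obtain ⟨β, hβ, hβ'⟩ := hloc _ h5 h3 (max s (u (φ n)))
  have h6 := h.maximal _ _ (hsol.glue (hs.trans (le_max_left s (u (φ n))))
    (EReal.coe_lt_coe_iff.2 (hmaxT (φ n))) hε hβ hβ')
  have h7 := EReal.coe_le_coe_iff.1 h6
  linarith

/-! ### Relative blow-up sets and their rescaled limits. -/

@[simp] lemma mem_innerGaps {N : ℕ} {l r : Fin N} {i : Fin (N - 1)} :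
    i ∈ innerGaps l r ↔ (l : ℕ) ≤ i ∧ (i : ℕ) < r := by simp [innerGaps]

@[simp] lemma mem_boundaryGaps {N : ℕ} {l r : Fin N} {i : Fin (N - 1)} :
    i ∈ boundaryGaps l r ↔ (i : ℕ) + 1 = l ∨ (i : ℕ) = r := by simp [boundaryGaps]

/-- The maximal interval around `k` on which a predicate holds. -/
lemma exists_maximal_interval {M : ℕ} (P : Fin M → Prop) {k : Fin M} (hk : P k) :
    ∃ l r : ℕ, l ≤ k ∧ (k : ℕ) < r ∧ r ≤ M ∧ (∀ i : Fin M, l ≤ i → (i : ℕ) < r → P i) ∧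
      ∀ i : Fin M, ((i : ℕ) + 1 = l ∨ (i : ℕ) = r) → ¬ P i := by
  classical
  have h1 : ∃ a : ℕ, a ≤ k ∧ ∀ i : Fin M, a ≤ i → (i : ℕ) ≤ k → P i :=
    ⟨k, le_rfl, fun i h h' => by rwa [Fin.ext (le_antisymm h' h)]⟩
  -- The value M qualifies vacuously, so an interval reaching the end gets r = M.
  have h2 : ∃ b : ℕ, (k : ℕ) < b ∧ ∀ i : Fin M, (i : ℕ) = b → ¬ P i :=
    ⟨M, k.2, fun i h => absurd i.2 (by omega)⟩
  refine ⟨Nat.find h1, Nat.find h2, (Nat.find_spec h1).1, (Nat.find_spec h2).1,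
    Nat.find_min' h2 ⟨k.2, fun i h => absurd i.2 (by omega)⟩, fun i hi hi' => ?_, fun i hi => ?_⟩
  · rcases le_or_gt (i : ℕ) k with h | h
    · exact (Nat.find_spec h1).2 i hi h
    · have h3 := Nat.find_min h2 hi'
      by_contra hP
      refine h3 ⟨h, fun j hj => ?_⟩
      rwa [Fin.ext hj]
  · rcases hi with hi | hi
    · intro hP
      have h3 := Nat.find_min h1 (m := i) (by omega)
      refine h3 ⟨?_, fun j hj hj' => ?_⟩
      · have := (Nat.find_spec h1).1
        omega
      · rcases hj.lt_or_eq with h | h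
        · exact (Nat.find_spec h1).2 j (by omega) hj'
        · rwa [← Fin.ext h]
    · exact (Nat.find_spec h2).2 i hi

/-- Relative blow-up sets exist, after extraction of a subsequence. -/
lemma exists_isRelativeBlowUpSet {N : ℕ} {Y : ℕ → Config N} (hpos : ∀ n k, 0 < gap (Y n) k)
    {i : Fin (N - 1)} (hi : Tendsto (fun n => gap (Y n) i) atTop (𝓝 0)) :
    ∃ (φ : ℕ → ℕ) (l r : Fin N), StrictMono φ ∧
      IsRelativeBlowUpSet (fun n => Y (φ n)) l r := by
  have hmin : ∀ n, ∃ k, ∀ k', gap (Y n) k ≤ gap (Y n) k' := fun n =>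
    haveI : Nonempty (Fin (N - 1)) := ⟨i⟩
    Finite.exists_min _
  choose k hk using hmin
  obtain ⟨k₀, φ₁, hφ₁, hφ₁k⟩ := exists_const_subseq k
  have hk₀ : ∀ n k', gap (Y (φ₁ n)) k₀ ≤ gap (Y (φ₁ n)) k' := fun n k' => by
    have := hk (φ₁ n) k'
    rwa [hφ₁k n] at this
  -- Quotients of the smallest gap by the others lie in [0, 1], so they converge along a
  -- subsequence. The gaps of comparable size are those with positive limit.
  obtain ⟨c, hc, φ₂, hφ₂, hlim⟩ :=
    (isCompact_univ_pi fun _ : Fin (N - 1) => isCompact_Icc (a := (0 : ℝ)) (b := 1)).tendsto_subseq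
      (x := fun n k' => gap (Y (φ₁ n)) k₀ / gap (Y (φ₁ n)) k') fun n k' _ =>
        ⟨(div_pos (hpos _ _) (hpos _ _)).le, div_le_one_of_le₀ (hk₀ n k') (hpos _ _).le⟩
  set y : ℕ → Config N := fun n => Y (φ₁ (φ₂ n)) with hy
  have hypos : ∀ n k, 0 < gap (y n) k := fun n k => hpos _ _
  have hq : ∀ k', Tendsto (fun n => gap (y n) k₀ / gap (y n) k') atTop (𝓝 (c k')) := fun k' =>
    (tendsto_pi_nhds.1 hlim) k'
  have hck₀ : c k₀ = 1 := tendsto_nhds_unique (hq k₀)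
    (by simp [fun n => div_self (hypos n k₀).ne'])
  have h0 : Tendsto (fun n => gap (y n) k₀) atTop (𝓝 0) :=
    squeeze_zero (fun n => (hypos n k₀).le) (fun n => hk₀ _ i)
      ((hi.comp hφ₁.tendsto_atTop).comp hφ₂.tendsto_atTop)
  have hratio : ∀ a b, 0 < c a →
      Tendsto (fun n => gap (y n) a / gap (y n) b) atTop (𝓝 (c b / c a)) := fun a b ha => by
    refine ((hq b).div (hq a) ha.ne').congr fun n => ?_
    have h1 := (hypos n k₀).ne'
    have h2 := (hypos n a).ne'
    have h3 := (hypos n b).ne'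
    simp only [Pi.div_apply]
    field_simp
  obtain ⟨l, r, h1, h2, h3, h4, h5⟩ := exists_maximal_interval (fun a => 0 < c a) (k := k₀)
    (by simp [hck₀])
  have hrN : r < N := by have := k₀.2; omega
  refine ⟨φ₁ ∘ φ₂, ⟨l, by omega⟩, ⟨r, hrN⟩, hφ₁.comp hφ₂, ?_, ?_, ?_, ?_⟩
  · simp only [Fin.mk_lt_mk]; omega
  · intro a ha
    rw [mem_innerGaps] at ha
    have hca := h4 a ha.1 ha.2
    have := h0.mul (hratio a k₀ hca)
    rw [zero_mul] at this
    refine this.congr fun n => ?_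
    have h1 := (hypos n k₀).ne'
    have h2 := (hypos n a).ne'
    change gap (y n) k₀ * (gap (y n) a / gap (y n) k₀) = gap (y n) a
    field_simp
  · intro a ha b
    rw [mem_innerGaps] at ha
    exact ⟨_, hratio a b (h4 a ha.1 ha.2)⟩
  · intro a ha b hb
    rw [mem_innerGaps] at ha
    rw [mem_boundaryGaps] at hb
    have hcb : c b = 0 := le_antisymm (not_lt.1 (h5 b hb)) (hc b (Set.mem_univ _)).1
    have := hratio a b (h4 a ha.1 ha.2)
    rwa [hcb, zero_div] at this

/-- The inclusion of a block of `p` consecutive particles. -/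
def blockEmb {N : ℕ} (l : Fin N) (p : ℕ) (h : (l : ℕ) + p ≤ N) : Fin p ↪ Fin N where
  toFun a := ⟨l + a, by omega⟩
  inj' a b hab := by
    simp only [Fin.mk.injEq, Nat.add_left_cancel_iff] at hab
    exact Fin.ext hab

@[simp] lemma blockEmb_val {N : ℕ} (l : Fin N) (p : ℕ) (h : (l : ℕ) + p ≤ N) (a : Fin p) :
    (blockEmb l p h a : ℕ) = l + a := rfl

section Block

variable {N : ℕ} {Y : ℕ → Config N} {l r : Fin N}

lemma blockSize_pos (hY : ∀ n i j, i < j → Y n i < Y n j) (hlr : l < r) (n : ℕ) :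
    0 < blockSize (Y n) l r := by
  have h := Fin.lt_def.1 hlr
  refine Real.sqrt_pos.2 (Finset.sum_pos (fun i _ => pow_pos (gap_pos (hY n) i) 2)
    ⟨⟨l, by omega⟩, ?_⟩)
  simpa using h

/-- The quotient is the Euclidean norm of the quotients of single gaps. Inside the block the limit
is at least 1, since a gap divided by itself is 1. -/
lemma IsRelativeBlowUpSet.tendsto_blockSize_div (h : IsRelativeBlowUpSet Y l r)
    (hY : ∀ n i j, i < j → Y n i < Y n j) :
    ∃ L : Fin (N - 1) → ℝ,
      (∀ k, Tendsto (fun n => blockSize (Y n) l r / gap (Y n) k) atTop (𝓝 (L k))) ∧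
      (∀ k, 0 ≤ L k) ∧ (∀ k ∈ innerGaps l r, 0 < L k) ∧ ∀ k ∈ boundaryGaps l r, L k = 0 := by
  have hpos : ∀ n k, 0 < gap (Y n) k := fun n k => gap_pos (hY n) k
  choose! c hc using h.fastest
  have heq : ∀ n k, blockSize (Y n) l r / gap (Y n) k =
      √(∑ i ∈ innerGaps l r, (gap (Y n) i / gap (Y n) k) ^ 2) := fun n k => by
    rw [blockSize, ← Real.sqrt_sq (hpos n k).le, ← Real.sqrt_div' _ (sq_nonneg _),
      Finset.sum_div, Real.sqrt_sq (hpos n k).le]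
    simp only [div_pow]
  have hlim : ∀ k, Tendsto (fun n => blockSize (Y n) l r / gap (Y n) k) atTop
      (𝓝 (√(∑ i ∈ innerGaps l r, c i k ^ 2))) := fun k => by
    simp only [heq]
    exact (tendsto_finsetSum _ fun i hi => (hc i hi k).pow 2).sqrt
  refine ⟨_, hlim, fun k => Real.sqrt_nonneg _, fun k hk => ?_, fun k hk => ?_⟩
  · refine Real.sqrt_pos.2 (lt_of_lt_of_le one_pos ?_)
    have h1 : c k k = 1 := tendsto_nhds_unique (hc k hk k)
      (by simp [fun n => div_self (hpos n k).ne'])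
    calc (1 : ℝ) = c k k ^ 2 := by rw [h1]; norm_num
      _ ≤ _ := Finset.single_le_sum (f := fun i => c i k ^ 2) (fun i _ => sq_nonneg _) hk
  · have h1 : ∀ i ∈ innerGaps l r, c i k = 0 := fun i hi =>
      tendsto_nhds_unique (hc i hi k) (h.isolated i hi k hk)
    rw [Finset.sum_congr rfl fun i hi => by rw [h1 i hi]]
    simp

lemma IsRelativeBlowUpSet.tendsto_blockSize (h : IsRelativeBlowUpSet Y l r) :
    Tendsto (fun n => blockSize (Y n) l r) atTop (𝓝 0) := by
  have h1 : Tendsto (fun n => √(∑ i ∈ innerGaps l r, gap (Y n) i ^ 2)) atTop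
      (𝓝 (√(∑ i ∈ innerGaps l r, (0 : ℝ) ^ 2))) :=
    (tendsto_finsetSum _ fun i hi => (h.collapse i hi).pow 2).sqrt
  simpa [blockSize] using h1

/-- No gap is of smaller order than the block; this provides the lower bound on all gaps that
`IsGlobalFlow.exists_velocity_lt` asks for. -/
lemma IsRelativeBlowUpSet.exists_mul_blockSize_le (h : IsRelativeBlowUpSet Y l r)
    (hY : ∀ n i j, i < j → Y n i < Y n j) :
    ∃ c > 0, ∀ᶠ n in atTop, ∀ k, c * blockSize (Y n) l r ≤ gap (Y n) k := by
  obtain ⟨L, hL, hL0, -, -⟩ := h.tendsto_blockSize_div hY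
  have hs : 0 ≤ ∑ k, L k := Finset.sum_nonneg fun k _ => hL0 k
  refine ⟨(∑ k, L k + 1)⁻¹, by positivity, eventually_all.2 fun k => ?_⟩
  have h1 : L k < ∑ k, L k + 1 := by
    have := Finset.single_le_sum (f := L) (fun i _ => hL0 i) (Finset.mem_univ k)
    linarith
  filter_upwards [(hL k).eventually_lt_const h1] with n hn
  rw [div_lt_iff₀ (gap_pos (hY n) k)] at hn
  rw [inv_mul_le_iff₀ (by positivity)]
  exact hn.le

lemma sum_Icc_eq_sum_range {p : ℕ} (hp : (l : ℕ) + p = r + 1) (Z : Config N) :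
    ∑ i ∈ Finset.Icc l r, Z i = ∑ a ∈ Finset.range p, toSeq Z (l + a) := by
  have hr := r.2
  refine Finset.sum_bij' (i := fun i _ => (i : ℕ) - l)
    (j := fun a ha => ⟨l + a, by rw [Finset.mem_range] at ha; omega⟩) ?_ ?_ ?_ ?_ ?_
  · intro i hi
    rw [Finset.mem_Icc, Fin.le_def, Fin.le_def] at hi
    rw [Finset.mem_range]; omega
  · intro a ha
    rw [Finset.mem_range] at ha
    rw [Finset.mem_Icc, Fin.le_def, Fin.le_def]
    simp only; omega
  · intro i hi
    rw [Finset.mem_Icc, Fin.le_def, Fin.le_def] at hi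
    exact Fin.ext (by simp only; omega)
  · intro a ha
    simp
  · intro i hi
    rw [Finset.mem_Icc, Fin.le_def, Fin.le_def] at hi
    rw [show (l : ℕ) + (i - l) = i by omega, toSeq_val]

lemma card_Icc_eq {p : ℕ} (hp : (l : ℕ) + p = r + 1) : (Finset.Icc l r).card = p := by
  rw [Fin.card_Icc]; omega

/-- A relative blow-up set converges, once renormalised. -/
lemma IsRelativeBlowUpSet.exists_limit (h : IsRelativeBlowUpSet Y l r)
    (hY : ∀ n i j, i < j → Y n i < Y n j) {p : ℕ} (hp : (l : ℕ) + p = r + 1) :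
    ∃ W ∈ orderedConfigs p, ∑ k, gap W k ^ 2 = 1 ∧ BlockConvergesTo Y l r W ∧
      ∀ a b : Fin p, ∀ i j : Fin N, (i : ℕ) = l + a → (j : ℕ) = l + b →
        Tendsto (fun n => (blockSize (Y n) l r)⁻¹ * Y n j - (blockSize (Y n) l r)⁻¹ * Y n i) atTop
          (𝓝 (W b - W a)) := by
  obtain ⟨L, hL, -, hLpos, -⟩ := h.tendsto_blockSize_div hY
  have hlr := Fin.lt_def.1 h.lt
  have hrN := r.2
  set ε : ℕ → ℝ := fun n => blockSize (Y n) l r with hε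
  have hε0 : ∀ n, 0 < ε n := blockSize_pos hY h.lt
  have hgap : ∀ k ∈ innerGaps l r, Tendsto (fun n => gap (Y n) k / ε n) atTop (𝓝 (L k)⁻¹) :=
    fun k hk => ((hL k).inv₀ (hLpos k hk).ne').congr fun n => inv_div _ _
  -- Positions measured from the left end of the block are partial sums of rescaled gaps; `ofSeq`
  -- recentres their limits.
  have hz : ∀ a < p, ∃ z, Tendsto (fun n => (toSeq (Y n) (l + a) - toSeq (Y n) l) / ε n)
      atTop (𝓝 z) := by
    intro a
    induction a with
    | zero => exact fun _ => ⟨0, by simp⟩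
    | succ a ih =>
      intro ha
      obtain ⟨z, hz⟩ := ih (by omega)
      have hk := hgap ⟨l + a, by omega⟩ (by simp; omega)
      refine ⟨_, (hz.add hk).congr fun n => ?_⟩
      rw [← toSeq_sub, ← add_div, ← add_assoc]
      congr 1
      simp only
      ring
  choose! z hz using hz
  have hzgap : ∀ a, ∀ ha : a + 1 < p, Tendsto (fun n => gap (Y n) ⟨l + a, by omega⟩ / ε n) atTop
      (𝓝 (z (a + 1) - z a)) := fun a ha => by
    refine ((hz (a + 1) ha).sub (hz a (by omega))).congr fun n => ?_
    rw [← toSeq_sub, ← sub_div, ← add_assoc]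
    congr 1
    simp only
    ring
  have hzmono : StrictMonoOn z (Set.Iio p) := by
    refine strictMonoOn_of_lt_succ Set.ordConnected_Iio fun a _ _ ha => ?_
    have ha : a + 1 < p := ha
    have hmem : (⟨l + a, by omega⟩ : Fin (N - 1)) ∈ innerGaps l r := by simp; omega
    have h1 := tendsto_nhds_unique (hzgap a ha) (hgap _ hmem)
    have h2 := inv_pos.2 (hLpos _ hmem)
    have : z a < z (a + 1) := by linarith
    exact this
  have hpp : (p : ℝ) ≠ 0 := by
    have : p ≠ 0 := by omega
    exact_mod_cast this
  refine ⟨ofSeq p z, ofSeq_mem hzmono, ?_, ?_, ?_⟩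
  · have h1 : Tendsto (fun n => ∑ k : Fin (p - 1), (gap (Y n) ⟨l + k, by omega⟩ / ε n) ^ 2) atTop
        (𝓝 (∑ k : Fin (p - 1), gap (ofSeq p z) k ^ 2)) := by
      refine tendsto_finsetSum _ fun k _ => Tendsto.pow ?_ 2
      have := hzgap k (by omega)
      convert this using 2
      rw [← toSeq_sub, toSeq_ofSeq _ (by omega), toSeq_ofSeq _ (by omega)]
      ring
    refine tendsto_nhds_unique h1 (tendsto_const_nhds.congr fun n => ?_)
    have h2 : ∑ k : Fin (p - 1), gap (Y n) ⟨l + k, by omega⟩ ^ 2 =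
        ∑ i ∈ innerGaps l r, gap (Y n) i ^ 2 := by
      refine Finset.sum_bij' (i := fun k _ => ⟨l + k, by omega⟩)
        (j := fun i hi => ⟨i - l, by rw [mem_innerGaps] at hi; omega⟩) ?_ ?_ ?_ ?_ ?_
      · intro k _
        have := k.2
        rw [mem_innerGaps]
        simp only
        omega
      · intro i _; exact Finset.mem_univ _
      · intro k _; simp
      · intro i hi
        rw [mem_innerGaps] at hi
        exact Fin.ext (by simp only; omega)
      · intro k _; rfl
    have h3 : ε n ^ 2 = ∑ i ∈ innerGaps l r, gap (Y n) i ^ 2 :=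
      Real.sq_sqrt (Finset.sum_nonneg fun i _ => sq_nonneg _)
    simp only [div_pow]
    rw [← Finset.sum_div, h2, ← h3, div_self (pow_ne_zero 2 (hε0 n).ne')]
  · intro i k hik
    have h1 : Tendsto (fun n => (toSeq (Y n) (l + k) - toSeq (Y n) l) / ε n -
        (∑ a ∈ Finset.range p, (toSeq (Y n) (l + a) - toSeq (Y n) l) / ε n) / p) atTop
        (𝓝 (z k - (∑ a ∈ Finset.range p, z a) / p)) :=
      (hz k k.2).sub ((tendsto_finsetSum _ fun a ha => hz a (Finset.mem_range.1 ha)).div_const _)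
    refine h1.congr fun n => ?_
    rw [blockCenter, sum_Icc_eq_sum_range hp, card_Icc_eq hp, ← hik, toSeq_val,
      ← Finset.sum_div, Finset.sum_sub_distrib, Finset.sum_const, Finset.card_range, nsmul_eq_mul]
    change _ = _ / ε n
    have := (hε0 n).ne'
    field_simp
    ring
  · intro a b i j hi hj
    have h1 := (hz b b.2).sub (hz a a.2)
    have h2 : (ofSeq p z) b - (ofSeq p z) a = z b - z a := by
      simp [ofSeq]
    rw [h2]
    refine h1.congr fun n => ?_
    simp only [← hi, ← hj, toSeq_val]
    change _ = (ε n)⁻¹ * _ - (ε n)⁻¹ * _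
    have := (hε0 n).ne'
    field_simp
    ring

lemma tendsto_rpow_neg_of_atTop {m : ℝ} (hm : 0 < m) {u : ℕ → ℝ} (hu : Tendsto u atTop atTop) :
    Tendsto (fun n => u n ^ (-m)) atTop (𝓝 0) :=
  (tendsto_rpow_neg_atTop hm).comp hu

/-- If the velocity is small compared with the size of the block, the renormalised limit of
a relative blow-up set is a stationary point of the system of its particles. -/
lemma IsRelativeBlowUpSet.velocity_limit_eq_zero (h : IsRelativeBlowUpSet Y l r)
    (hY : ∀ n i j, i < j → Y n i < Y n j) {m χ : ℝ} (hm : 1 < m)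
    (hv : Tendsto (fun n => blockSize (Y n) l r ^ m * ‖velocity m χ (Y n)‖) atTop (𝓝 0))
    {p : ℕ} (hp : (l : ℕ) + p = r + 1) {W : Config p} (hW : W ∈ orderedConfigs p)
    (hlim : ∀ a b : Fin p, ∀ i j : Fin N, (i : ℕ) = l + a → (j : ℕ) = l + b →
        Tendsto (fun n => (blockSize (Y n) l r)⁻¹ * Y n j - (blockSize (Y n) l r)⁻¹ * Y n i) atTop
          (𝓝 (W b - W a))) : velocity m χ W = 0 := by
  obtain ⟨L, hL, hL0, -, hLb⟩ := h.tendsto_blockSize_div hY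
  have hlr := Fin.lt_def.1 h.lt
  have hrN := r.2
  have hm0 : 0 < m := by linarith
  set ε : ℕ → ℝ := fun n => blockSize (Y n) l r with hε
  have hε0 : ∀ n, 0 < ε n := blockSize_pos hY h.lt
  set Z : ℕ → Config N := fun n => (ε n)⁻¹ • Y n with hZdef
  have hZ : ∀ n i j, i < j → Z n i < Z n j := fun n i j hij => by
    simpa [hZdef] using mul_lt_mul_of_pos_left (hY n i j hij) (inv_pos.2 (hε0 n))
  have hlim : ∀ a b : Fin p, ∀ i j : Fin N, (i : ℕ) = l + a → (j : ℕ) = l + b →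
      Tendsto (fun n => Z n j - Z n i) atTop (𝓝 (W b - W a)) := hlim
  -- After rescaling, the neighbours of the block escape to infinity, and their forces disappear.
  have hbd : ∀ k ∈ boundaryGaps l r, Tendsto (fun n => gap (Z n) k) atTop atTop := fun k hk => by
    have h1 : Tendsto (fun n => ε n / gap (Y n) k) atTop (𝓝[>] 0) := by
      refine tendsto_nhdsWithin_iff.2 ⟨?_, Eventually.of_forall fun n =>
        div_pos (hε0 n) (gap_pos (hY n) k)⟩
      have := hL k
      rwa [hLb k hk] at this
    refine (tendsto_inv_nhdsGT_zero.comp h1).congr fun n => ?_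
    simp only [Function.comp_apply, hZdef, gap_smul, inv_div]
    rw [div_eq_inv_mul]
  have hfar : ∀ i j : Fin N, (l : ℕ) ≤ i → (i : ℕ) ≤ r → ((j : ℕ) < l ∨ (r : ℕ) < j) →
      Tendsto (fun n => |Z n j - Z n i|) atTop atTop := by
    intro i j hi hi' hj
    have hmono : ∀ n, ∀ a b : Fin N, (a : ℕ) ≤ b → Z n a ≤ Z n b := fun n a b hab => by
      rcases hab.lt_or_eq with h1 | h1
      · exact (hZ n a b h1).le
      · rw [Fin.ext h1]
    rcases hj with hj | hj
    · refine tendsto_atTop_mono (fun n => ?_) (hbd ⟨l - 1, by omega⟩ (by simp; omega))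
      have h1 := hmono n ⟨l - 1 + 1, by omega⟩ i (by simp only; omega)
      have h2 := hmono n j ⟨l - 1, by omega⟩ (by simp only; omega)
      rw [abs_sub_comm]
      refine le_trans ?_ (le_abs_self _)
      rw [gap]
      linarith
    · refine tendsto_atTop_mono (fun n => ?_) (hbd ⟨r, by omega⟩ (by simp))
      have h1 := hmono n ⟨r + 1, by omega⟩ j (by simp only; omega)
      have h2 := hmono n i ⟨r, by omega⟩ (by simp only; omega)
      refine le_trans ?_ (le_abs_self _)
      rw [gap]
      linarith
  ext k
  have hkp := k.2
  set i : Fin N := blockEmb l p (by omega) k with hi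
  have hik : (i : ℕ) = l + k := rfl
  have hzero : Tendsto (fun n => velocity m χ (Z n) i) atTop (𝓝 0) := by
    refine squeeze_zero_norm (fun n => ?_) hv
    refine (abs_coord_le _ _).trans (le_of_eq ?_)
    rw [hZdef]
    simp only
    rw [velocity_smul (inv_pos.2 (hε0 n)) (hY n), norm_smul,
      Real.norm_of_nonneg (Real.rpow_nonneg (inv_pos.2 (hε0 n)).le _),
      Real.inv_rpow (hε0 n).le, Real.rpow_neg (hε0 n).le, inv_inv]
  refine tendsto_nhds_unique ?_ hzero
  simp only [velocity]
  refine (Tendsto.add (Tendsto.neg ?_) ?_).add (Tendsto.const_mul _ ?_)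
  · by_cases hk : (k : ℕ) + 1 < p
    · rw [dif_pos hk, funext fun n => dif_pos (show (i : ℕ) + 1 < N by omega)]
      exact (hlim k ⟨k + 1, hk⟩ i ⟨i + 1, by omega⟩ hik (by simp only; omega)).rpow_const
        (Or.inl (sub_pos.2 (hW.1 _ _ (by simp [Fin.lt_def]))).ne')
    -- At the right end of the block the next gap is infinite in the limit, or absent when the block
    -- contains the last particle.
    · rw [dif_neg hk]
      by_cases hN : (i : ℕ) + 1 < N
      · rw [funext fun n => dif_pos hN]
        exact tendsto_rpow_neg_of_atTop hm0 (hbd ⟨i, by omega⟩ (by simp; omega))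
      · rw [funext fun n => dif_neg hN]
        exact tendsto_const_nhds
  · by_cases hk : 0 < (k : ℕ)
    · rw [if_pos hk, funext fun n => if_pos (show 0 < (i : ℕ) by omega)]
      exact (hlim ⟨k - 1, by omega⟩ k ⟨i - 1, by omega⟩ i (by simp only; omega) hik).rpow_const
        (Or.inl (sub_pos.2 (hW.1 _ _ (by simp [Fin.lt_def]; omega))).ne')
    · rw [if_neg hk]
      by_cases hN : 0 < (i : ℕ)
      · rw [funext fun n => if_pos hN]
        refine tendsto_rpow_neg_of_atTop hm0 ((hbd ⟨i - 1, by omega⟩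
          (by simp; omega)).congr fun n => ?_)
        have e : (⟨(i : ℕ) - 1 + 1, by omega⟩ : Fin N) = i :=
          Fin.ext (by change (i : ℕ) - 1 + 1 = i; omega)
        change Z n ⟨(i : ℕ) - 1 + 1, by omega⟩ - Z n ⟨(i : ℕ) - 1, by omega⟩ = _
        rw [e]
      · rw [funext fun n => if_neg hN]
        exact tendsto_const_nhds
  -- The limit of the force of particle j on particle i: the force within W for j in the block, zero
  -- otherwise.
  · set g : Fin N → ℝ := fun j => if (l : ℕ) ≤ j ∧ (j : ℕ) ≤ r then
      ((Int.sign ((j : ℤ) - (i : ℤ)) : ℤ) : ℝ) * |toSeq W (j - l) - W k| ^ (-m) else 0 with hg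
    have h1 : ∑ b : Fin p with b ≠ k,
        ((Int.sign ((b : ℤ) - (k : ℤ)) : ℤ) : ℝ) * |W b - W k| ^ (-m) =
        ∑ j : Fin N with j ≠ i, g j := by
      have h2 : ∑ b : Fin p with b ≠ k,
          ((Int.sign ((b : ℤ) - (k : ℤ)) : ℤ) : ℝ) * |W b - W k| ^ (-m) =
          ∑ j ∈ (Finset.univ.filter fun b : Fin p => b ≠ k).map (blockEmb l p (by omega)), g j := by
        rw [Finset.sum_map]
        refine Finset.sum_congr rfl fun b _ => ?_
        have hb := b.2
        have hbi : (l : ℕ) ≤ (blockEmb l p (by omega) b : Fin N) ∧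
            ((blockEmb l p (by omega) b : Fin N) : ℕ) ≤ r := by rw [blockEmb_val]; omega
        simp only [hg]
        rw [if_pos hbi, blockEmb_val, Nat.add_sub_cancel_left, toSeq_val, hik,
          show ((l + b : ℕ) : ℤ) - ((l + k : ℕ) : ℤ) = (b : ℤ) - (k : ℤ) by push_cast; ring]
      rw [h2]
      refine Finset.sum_subset (fun j hj => ?_) fun j hj hj' => ?_
      · obtain ⟨b, hb, rfl⟩ := Finset.mem_map.1 hj
        simp only [Finset.mem_filter, Finset.mem_univ, true_and] at hb ⊢
        exact fun h => hb ((blockEmb l p _).injective h)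
      · simp only [Finset.mem_filter, Finset.mem_univ, true_and] at hj
        simp only [hg]
        refine if_neg fun hb => hj' (Finset.mem_map.2 ⟨⟨j - l, by omega⟩, ?_, ?_⟩)
        · simp only [Finset.mem_filter, Finset.mem_univ, true_and]
          intro h3
          refine hj (Fin.ext ?_)
          rw [hik, ← h3]
          simp only
          omega
        · exact Fin.ext (by rw [blockEmb_val]; simp only; omega)
    rw [h1]
    refine tendsto_finsetSum _ fun j hj => ?_
    simp only [Finset.mem_filter, Finset.mem_univ, true_and] at hj
    simp only [hg]
    by_cases hb : (l : ℕ) ≤ j ∧ (j : ℕ) ≤ r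
    · rw [if_pos hb]
      refine Tendsto.const_mul _ ?_
      have h2 : toSeq W (j - l) = W ⟨j - l, by omega⟩ := toSeq_of_lt W (by omega)
      rw [h2]
      have hne : (⟨j - l, by omega⟩ : Fin p) ≠ k := fun h3 => by
        refine hj (Fin.ext ?_)
        rw [hik, ← h3]
        simp only
        omega
      have hne' : W ⟨j - l, by omega⟩ - W k ≠ 0 := by
        rcases lt_or_gt_of_ne hne with h | h
        · exact (sub_neg.2 (hW.1 _ _ h)).ne
        · exact (sub_pos.2 (hW.1 _ _ h)).ne'
      exact ((hlim k ⟨j - l, by omega⟩ i j hik (by simp only; omega)).abs).rpow_const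
        (Or.inl (abs_ne_zero.2 hne'))
    · rw [if_neg hb]
      have h2 := (tendsto_rpow_neg_of_atTop hm0 (hfar i j (by omega) (by omega)
        (by omega))).const_mul ((Int.sign ((j : ℤ) - (i : ℤ)) : ℤ) : ℝ)
      rwa [mul_zero] at h2

end Block

/-! ### Critical points produced by global solutions, and the conclusion. -/

/-- The relative blow-up sets of a global solution converge to critical points. -/
lemma IsGlobalFlow.exists_critical_limit {m χ : ℝ} {N : ℕ} {X : ℝ → Config N}
    (h : IsGlobalFlow m χ X) (hm : 1 < m) (hN : 2 ≤ N) {t : ℕ → ℝ} (ht : ∀ n, 0 ≤ t n)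
    {l r : Fin N} (hlr : IsRelativeBlowUpSet (fun n => normalized X (t n)) l r) {p : ℕ}
    (hp : (l : ℕ) + p = r + 1) :
    ∃ W ∈ orderedConfigs p, velocity m χ W = 0 ∧ ∑ k, gap W k ^ 2 = 1 ∧
      BlockConvergesTo (fun n => normalized X (t n)) l r W := by
  have hY : ∀ n, ∀ i j : Fin N, i < j → normalized X (t n) i < normalized X (t n) j := fun n =>
    (normalized_mem hN (h.mem _ (ht n))).1
  obtain ⟨W, hW, hW1, hconv, hlim⟩ := hlr.exists_limit hY hp
  refine ⟨W, hW, hlr.velocity_limit_eq_zero hY hm ?_ hp hW hlim, hW1, hconv⟩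
  obtain ⟨c, hc, hgap⟩ := hlr.exists_mul_blockSize_le hY
  have hε0 : ∀ n, 0 < blockSize (normalized X (t n)) l r := blockSize_pos hY hlr.lt
  have hcm : 0 < c ^ m := Real.rpow_pos_of_pos hc m
  refine tendsto_order.2 ⟨fun a ha => Eventually.of_forall fun n => ha.trans_le
    (mul_nonneg (Real.rpow_nonneg (hε0 n).le _) (norm_nonneg _)), fun θ hθ => ?_⟩
  -- Applied below with η = c · `blockSize`; the factor c^m in the tolerance then cancels.
  obtain ⟨η₀, hη₀, hη⟩ := h.exists_velocity_lt hm hN (mul_pos hcm hθ)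
  have hlt : ∀ᶠ n in atTop, c * blockSize (normalized X (t n)) l r < η₀ := by
    have := hlr.tendsto_blockSize.const_mul c
    rw [mul_zero] at this
    exact this.eventually_lt_const hη₀
  filter_upwards [hgap, hlt] with n h1 h2
  have h3 := hη (t n) (ht n) _ (mul_pos hc (hε0 n)) h2 h1
  rw [Real.mul_rpow hc.le (hε0 n).le, mul_assoc] at h3
  exact lt_of_mul_lt_mul_left h3 hcm.le

/-- A global solution above the threshold produces a critical point of the energy of some
smaller number of particles. -/
lemma IsGlobalFlow.exists_critical {m χ : ℝ} {N : ℕ} {X : ℝ → Config N}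
    (h : IsGlobalFlow m χ X) (hm : 1 < m) (hN : 2 ≤ N) (hχ : threshold m N < χ) :
    ∃ p, 2 ≤ p ∧ p < N ∧ χ = threshold m p ∧ ∃ W ∈ orderedConfigs p, velocity m χ W = 0 ∧
      ∑ k, gap W k ^ 2 = 1 := by
  obtain ⟨i, t, ht, hi⟩ := h.blowsUp_normalized hm hN hχ
  obtain ⟨φ, l, r, -, hlr⟩ := exists_isRelativeBlowUpSet
    (fun n => gap_pos (normalized_mem hN (h.mem _ (ht.1 n).1)).1) hi
  have h1 := Fin.lt_def.1 hlr.lt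
  have h2 := r.2
  obtain ⟨W, hW, hW0, hW1, -⟩ := h.exists_critical_limit hm hN (fun n => (ht.1 (φ n)).1) hlr
    (p := r + 1 - l) (by omega)
  have h3 := eq_threshold_of_critical hm ((threshold_pos hm hN).trans hχ) (by omega) hW hW0
  -- A block of all N particles would give χ = C_N.
  refine ⟨_, by omega, lt_of_le_of_ne (by omega) fun h4 => ?_, h3, W, hW, hW0, hW1⟩
  rw [h4] at h3
  exact absurd h3 hχ.ne'

end ParticleFlow

end

theorem mainTheorem1 (m χ : ℝ) (hm : 1 < m) (N : ℕ) (hN : 2 ≤ N)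
    (hχ : ParticleFlow.threshold m N < χ)
    (X₀ : ParticleFlow.Config N) (hX₀ : X₀ ∈ ParticleFlow.orderedConfigs N)
    (T : EReal) (X : ℝ → ParticleFlow.Config N)
    (hX : ParticleFlow.IsMaximalSolution m χ X₀ T X) :
    -- if `χ` is not a threshold, then blow-up in finite time
    ((∀ p : ℕ, 2 ≤ p → p < N → χ ≠ ParticleFlow.threshold m p) →
      T < ⊤ ∧ ParticleFlow.BlowsUp T X) ∧
    -- if `χ` is the threshold `C_p`, then the alternative
    (∀ p : ℕ, 2 ≤ p → p < N → χ = ParticleFlow.threshold m p →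
      (T < ⊤ ∧ ParticleFlow.BlowsUp T X) ∨
      (T = ⊤ ∧ ParticleFlow.BlowsUp T (ParticleFlow.normalized X) ∧
        -- relative blow-up sets exist, after extraction of a subsequence
        (∀ (t : ℕ → ℝ) (i : Fin (N - 1)), ParticleFlow.TimesTo T t →
          Tendsto (fun n => ParticleFlow.gap (ParticleFlow.normalized X (t n)) i) atTop (𝓝 0) →
          ∃ (φ : ℕ → ℕ) (l r : Fin N), StrictMono φ ∧
            ParticleFlow.IsRelativeBlowUpSet
              (fun n => ParticleFlow.normalized X (t (φ n))) l r) ∧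
        -- each of them has `p` particles and converges, once renormalised, to the critical
        -- point of the energy of `p` particles, which is unique up to dilation
        ∃ V : ParticleFlow.Config p,
          ParticleFlow.IsCriticalPoint m χ V ∧
          ∑ k : Fin (p - 1), ParticleFlow.gap V k ^ 2 = 1 ∧
          (∀ W : ParticleFlow.Config p, ParticleFlow.IsCriticalPoint m χ W →
            ∃ a : ℝ, 0 < a ∧ W = a • V) ∧
          ∀ (t : ℕ → ℝ) (l r : Fin N), ParticleFlow.TimesTo T t →
            ParticleFlow.IsRelativeBlowUpSet
              (fun n => ParticleFlow.normalized X (t n)) l r →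
            (Finset.Icc l r).card = p ∧
            ParticleFlow.BlockConvergesTo
              (fun n => ParticleFlow.normalized X (t n)) l r V)) := by
  open ParticleFlow in
  rcases lt_or_eq_of_le (le_top : T ≤ ⊤) with hT | rfl
  · have hb := hX.blowsUp (by linarith) hT
    exact ⟨fun _ => ⟨hT, hb⟩, fun _ _ _ _ => Or.inl ⟨hT, hb⟩⟩
  have h := hX.sol.isGlobalFlow
  have hχ0 : 0 < χ := (threshold_pos hm hN).trans hχ
  obtain ⟨q, hq2, hqN, hq, V, hV, hV0, hV1⟩ := h.exists_critical hm hN hχ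
  refine ⟨fun hne => absurd hq (hne q hq2 hqN), fun p hp2 _ hp => Or.inr
    ⟨rfl, h.blowsUp_normalized hm hN hχ, fun t i ht hi => ?_, ?_⟩⟩
  · obtain ⟨φ, l, r, hφ, hlr⟩ := exists_isRelativeBlowUpSet
      (fun n => gap_pos (normalized_mem hN (h.mem _ (ht.1 n).1)).1) hi
    exact ⟨φ, l, r, hφ, hlr⟩
  · subst hp
    obtain rfl : q = p := card_eq_of_critical hm hq2 hp2 hV hV0
    refine ⟨V, (isCriticalPoint_iff hm).2 ⟨hV, hV0⟩, hV1, fun W hW => ?_, fun t l r ht hlr => ?_⟩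
    · rw [isCriticalPoint_iff hm] at hW
      exact critical_unique hm hχ0 hp2 hV hV0 hW.1 hW.2
    · have h1 := Fin.lt_def.1 hlr.lt
      have h2 := r.2
      obtain ⟨s, hs⟩ : ∃ s, (l : ℕ) + s = r + 1 := ⟨r + 1 - l, by omega⟩
      obtain ⟨W, hW, hW0, hW1, hconv⟩ := h.exists_critical_limit hm hN (fun n => (ht.1 n).1) hlr hs
      obtain rfl : s = q := card_eq_of_critical hm (by omega) hp2 hW hW0
      refine ⟨card_Icc_eq hs, ?_⟩
      -- The limit of the block is a dilate of V with the same normalisation of the gaps, which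
      -- forces a = 1.
      obtain ⟨a, ha, rfl⟩ := critical_unique hm hχ0 hp2 hV hV0 hW hW0
      simp only [gap_smul, mul_pow, ← Finset.mul_sum, hV1, mul_one] at hW1
      have ha1 : a = 1 := by nlinarith
      rwa [ha1, one_smul] at hconv
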